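/- **Principle of Maximal Work.** *Setting.* A system with phase space points $x=(q,p)\in\mathbb R^n\times\mathbb R^n$ and intrinsic Hamiltonian $H(x)$ is coupled to a heat bath with phase space points $y=(Q,P)\in\mathbb R^m\times\mathbb R^m$ and Hamiltonian $H^b(y)$ by an interaction energy $H_{\rm int}(x,y)$ (all $C^2$), and is driven by an external force $f(q,t)$ ($C^1$, not necessarily conservative, independent of the momenta). The whole evolves by Hamilton's equations for $H+H^b+H_{\rm int}$ with $f$ added to $\dot p$; it is assumed that this evolution is defined for all times $s,t\ge 0$, and $U(s,t)$ denotes the evolution from time $s$ to time $t$, acting on densities by $U(s,t)\rho=\rho\circ U(s,t)^{-1}$. Integrals are with respect to the dimensionless Liouville measure $d\omega = dq\,dp/h^n$ (and its analogues for the bath and for the whole), and $|\cdot|$ is the corresponding volume. The system's phase space is partitioned into countably many measurable Boltzmann cells $A,B,\dots$ of positive finite volume, the bath's into the energy shells $\Omega^b_j=\{j\Delta\le H^b<(j+1)\Delta\}$, $j\in\mathbb Z$, and the phase space of the whole into the products $B\times\Omega^b_j$. $\mathcal C$ denotes coarse-graining, i.e. averaging of a density over each cell of the partition. *Thermostat assumptions,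 at temperature $T>0$ and with tolerances $\varepsilon,\delta$, $\eta(t)\ge0$.* (i) $H$ varies by at most $\varepsilon$ in each Boltzmann cell. (ii) $|H_{\rm int}|\le\delta$. (iii) The bath is ideal: $\log|\Omega^b_j|=s_0+j\Delta/T$ for every non-empty shell, with a constant $s_0$. (iv) The bath remains in thermal equilibrium: given the Boltzmann cell of the system at time $t\ge0$, it is in one Boltzmann state $\Omega^b_j$, up to conditional Shannon entropy $\eta(t)$ of the label $j$ given the cell. *Process.* At $t=0$ the whole is in the Boltzmann state $\rho_0=\chi_{A\times\Omega^b_k}/|A\times\Omega^b_k|$. Let $\rho(t)=U(0,t)\rho_0$, let $\tilde\rho(t)$ be the coarse-grained marginal density of the system at time $t$, let $$F[\tilde\rho,T]=\int\tilde\rho\,(H+T\log\tilde\rho)\,d\omega,\qquad \langle W\rangle_t=\Big\langle\int_0^t f(q(s),s)\cdot\dot q(s)\,ds\Big\rangle_{\rho_0}$$ be the coarse-grained free energy and the average work of the external force up to time $t$, and let $D(t)=\langle W\rangle_t-\big(F[\tilde\rho(t),T]-F[\tilde\rho(0),T]\big)$. Assume that for every $t\ge0$ the work is integrable with respect to $\rho_0$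 and that $\tilde\rho(t)H$ and $\tilde\rho(t)\log\tilde\rho(t)$ are integrable. Put $\kappa(t)=2\varepsilon+2\delta+\Delta+T\eta(t)$. *Conclusion.* Up to the error $\kappa$, which vanishes with the tolerances $\varepsilon,\delta,\Delta,\eta$, the average work is at least the change of the coarse-grained free energy, and the difference increases with time beyond the local mixing time: 1. $\langle W\rangle_t\ \ge\ F[\tilde\rho(t),T]-F[\tilde\rho(0),T]-\kappa(t)$ for all $t\ge0$. 2. If the dynamics of the whole is locally mixing beyond the time $\tau_{\rm LM}\ge0$, i.e. $\mathcal C U(0,t+\tau)\mathcal C=\mathcal C U(\tau,t+\tau)\mathcal C U(0,\tau)\mathcal C$ on integrable functions for all $t,\tau\ge\tau_{\rm LM}$, then $D(t+\tau)\ge D(\tau)-\kappa(t+\tau)$ for all $t,\tau\ge\tau_{\rm LM}$. 3. If the dynamics of the whole is locally mixing only in the limit, i.e. the difference of the two sides of that identity, applied to any integrable function, tends to $0$ in $L^1$ as $t,\tau\to\infty$, and if the accessible phase space volume is finite (there is a set of finite volume outside of which all $\mathcal C U(\tau,t+\tau)\mathcal C U(0,\tau)\rho_0$, $t,\tau\ge0$,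 vanish), then for every $\varepsilon'>0$ there is $\tau_0\ge0$ with $D(t+\tau)\ge D(\tau)-\kappa(t+\tau)-\varepsilon'$ for all $t,\tau\ge\tau_0$. -/

import Mathlib

open MeasureTheory Filter Topology
open scoped ENNReal NNReal Gradient

noncomputable section

/-- Configurations: `n` canonical coordinates (or momenta). -/
abbrev Config (n : ℕ) : Type := EuclideanSpace ℝ (Fin n)

/-- Phase space: pairs `(q, p)` of canonical coordinates and momenta. -/
abbrev PhaseSpace (n : ℕ) : Type := Config n × Config n

/-- Coarse-graining with respect to the partition into the cells `c ⁻¹' {i}`: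
the value at `x` is the average of `ρ` over the cell that contains `x`. -/
def coarseGrain {Γ κ : Type*} [MeasurableSpace Γ] (μ : Measure Γ) (c : Γ → κ) (ρ : Γ → ℝ) :
    Γ → ℝ :=
  fun x => ⨍ y in c ⁻¹' {c x}, ρ y ∂μ

/-- Action of the evolution on functions: `(U(s,t) ρ)(x) = ρ(U(s,t)⁻¹ x)`. For the evolution of
a system of ordinary differential equations the inverse of `U(s,t)` is `U(t,s)`. -/
def evolveDensity {Γ : Type*} (U : ℝ → ℝ → Γ → Γ) (s t : ℝ) (ρ : Γ → ℝ) : Γ → ℝ :=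
  fun x => ρ (U t s x)

/-- The operator identity `C U(0,t+τ) C = C U(τ,t+τ) C U(0,τ) C` on integrable functions,
for all times `t, τ` beyond the local mixing time `τLM`. -/
def LocallyMixingBeyond {Γ κ : Type*} [MeasurableSpace Γ] (μ : Measure Γ) (c : Γ → κ)
    (U : ℝ → ℝ → Γ → Γ) (τLM : ℝ) : Prop :=
  ∀ ρ : Γ → ℝ, Integrable ρ μ → ∀ t τ : ℝ, τLM ≤ t → τLM ≤ τ →
    coarseGrain μ c (evolveDensity U 0 (t + τ) (coarseGrain μ c ρ)) =
      coarseGrain μ c (evolveDensity U τ (t + τ)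
        (coarseGrain μ c (evolveDensity U 0 τ (coarseGrain μ c ρ))))

/-- The same operator identity in the limit `t, τ → ∞`: on every integrable function the two
sides become equal in `L¹`. -/
def LocallyMixingInLimit {Γ κ : Type*} [MeasurableSpace Γ] (μ : Measure Γ) (c : Γ → κ)
    (U : ℝ → ℝ → Γ → Γ) : Prop :=
  ∀ ρ : Γ → ℝ, Integrable ρ μ →
    Tendsto (fun r : ℝ × ℝ =>
      ∫ x, |coarseGrain μ c (evolveDensity U 0 (r.1 + r.2) (coarseGrain μ c ρ)) x -
        coarseGrain μ c (evolveDensity U r.2 (r.1 + r.2)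
          (coarseGrain μ c (evolveDensity U 0 r.2 (coarseGrain μ c ρ)))) x| ∂μ)
      (atTop ×ˢ atTop) (𝓝 0)

/-- The dimensionless Liouville measure `dω = dq dp / h ^ n`. -/
def liouville (h : ℝ) (n : ℕ) : Measure (PhaseSpace n) :=
  ENNReal.ofReal ((h ^ n)⁻¹) • volume

/-- The coarse-grained free energy `F[ρ, T] = ∫ ρ (H + T log ρ) dω`. -/
def freeEnergy {n : ℕ} (h : ℝ) (H : PhaseSpace n → ℝ) (T : ℝ) (ρ : PhaseSpace n → ℝ) : ℝ :=
  ∫ x, ρ x * (H x + T * Real.log (ρ x)) ∂(liouville h n)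

/-- A mechanical system with `n` degrees of freedom, driven by external forces, together with a
heat bath with `m` degrees of freedom, and the partitions used to describe them. -/
structure DrivenSystemWithBath (n m : ℕ) (ι : Type*) where
  /-- intrinsic Hamiltonian of the system, without the external forces -/
  H : PhaseSpace n → ℝ
  /-- Hamiltonian of the heat bath -/
  Hb : PhaseSpace m → ℝ
  /-- interaction energy of system and bath -/
  Hint : PhaseSpace n × PhaseSpace m → ℝ
  /-- external force, a function of the coordinates of the system and of time -/
  force : Config n → ℝ → Config n
  /-- the label of the Boltzmann cell that contains a micro-state of the system -/
  cell : PhaseSpace n → ι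
  /-- width of the energy shells of the bath -/
  width : ℝ
  /-- unit of phase space area per degree of freedom -/
  h : ℝ

namespace DrivenSystemWithBath

variable {n m : ℕ} {ι : Type*} (S : DrivenSystemWithBath n m ι)

/-- The Hamiltonian of system plus bath, without the external forces. -/
def Htot (z : PhaseSpace n × PhaseSpace m) : ℝ := S.H z.1 + S.Hb z.2 + S.Hint z

/-- The Boltzmann cell with label `A`. -/
def cellSet (A : ι) : Set (PhaseSpace n) := S.cell ⁻¹' {A}

/-- The number of the bath energy shell that contains `y`. -/
def shell (y : PhaseSpace m) : ℤ := ⌊S.Hb y / S.width⌋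

/-- The energy shell `{k Δ ≤ Hb < (k + 1) Δ}` of the bath, where `Δ` is the width. -/
def shellSet (k : ℤ) : Set (PhaseSpace m) := S.shell ⁻¹' {k}

/-- The label of the cell `B ⊗ Ω^b(E)` of system plus bath that contains `z`. -/
def jointCell (z : PhaseSpace n × PhaseSpace m) : ι × ℤ := (S.cell z.1, S.shell z.2)

/-- The dimensionless Liouville measure of system plus bath. -/
def jointMeasure : Measure (PhaseSpace n × PhaseSpace m) :=
  ENNReal.ofReal ((S.h ^ (n + m))⁻¹) • volume

/-- Smoothness of the Hamiltonians and of the force, and the cells form a partition into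
measurable sets of positive finite volume. -/
structure Regular : Prop where
  contDiff_H : ContDiff ℝ 2 S.H
  contDiff_Hb : ContDiff ℝ 2 S.Hb
  contDiff_Hint : ContDiff ℝ 2 S.Hint
  contDiff_force : ContDiff ℝ 1 (fun x : Config n × ℝ => S.force x.1 x.2)
  h_pos : 0 < S.h
  width_pos : 0 < S.width
  measurableSet_cellSet : ∀ A, MeasurableSet (S.cellSet A)
  volume_pos : ∀ A, 0 < liouville S.h n (S.cellSet A)
  volume_lt_top : ∀ A, liouville S.h n (S.cellSet A) < ∞

/-- The right-hand side of Hamilton's equations of system plus bath,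
`q' = ∂Htot/∂p`, `p' = -∂Htot/∂q + f(q,t)` for the system and
`Q' = ∂Htot/∂P`, `P' = -∂Htot/∂Q` for the bath. -/
def hamiltonField (t : ℝ) (z : PhaseSpace n × PhaseSpace m) : PhaseSpace n × PhaseSpace m :=
  ((∇ (fun p => S.Htot ((z.1.1, p), z.2)) z.1.2,
    -∇ (fun q => S.Htot ((q, z.1.2), z.2)) z.1.1 + S.force z.1.1 t),
   (∇ (fun P => S.Htot (z.1, (z.2.1, P))) z.2.2,
    -∇ (fun Q => S.Htot (z.1, (Q, z.2.2))) z.2.1))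

/-- `U s t` maps a micro-state at time `s` to the micro-state at time `t` that it evolves to
(or, for `t < s`, from) by Hamilton's equations; times are non-negative. -/
def IsEvolution (U : ℝ → ℝ → PhaseSpace n × PhaseSpace m → PhaseSpace n × PhaseSpace m) : Prop :=
  ∀ s, 0 ≤ s → ∀ z, U s s z = z ∧
    ∀ t, 0 ≤ t → HasDerivWithinAt (fun r => U s r z) (S.hamiltonField t (U s t z)) (Set.Ici 0) t

/-- Ideal heat bath of temperature `T`: the Boltzmann entropy of an energy shell is an affine
function of its energy, with slope `1 / T`. -/
def IdealBath (T : ℝ) : Prop :=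
  ∃ s₀ : ℝ, ∀ k : ℤ, (S.shellSet k).Nonempty →
    liouville S.h m (S.shellSet k) = ENNReal.ofReal (Real.exp (s₀ + k * S.width / T))

/-- The initial state: system in the Boltzmann state `A`, bath in the Boltzmann state of its
`k`-th energy shell, i.e. the uniform density on the product of the two. -/
def initialDensity (A : ι) (k : ℤ) : PhaseSpace n × PhaseSpace m → ℝ :=
  (S.cellSet A ×ˢ S.shellSet k).indicator
    (fun _ => (S.jointMeasure.real (S.cellSet A ×ˢ S.shellSet k))⁻¹)

variable (U : ℝ → ℝ → PhaseSpace n × PhaseSpace m → PhaseSpace n × PhaseSpace m)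

/-- The density of system plus bath at time `t`. -/
def density (A : ι) (k : ℤ) (t : ℝ) : PhaseSpace n × PhaseSpace m → ℝ :=
  evolveDensity U 0 t (S.initialDensity A k)

/-- The coarse-grained density of the system at time `t`: the bath is integrated out and the
resulting density is averaged over the Boltzmann cells. -/
def systemDensity (A : ι) (k : ℤ) (t : ℝ) : PhaseSpace n → ℝ :=
  coarseGrain (liouville S.h n) S.cell
    (fun x => ∫ y, S.density U A k t (x, y) ∂(liouville S.h m))

/-- The change of the coarse-grained free energy of the system from time `0` to time `t`. -/
def freeEnergyChange (T : ℝ) (A : ι) (k : ℤ) (t : ℝ) : ℝ :=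
  freeEnergy S.h S.H T (S.systemDensity U A k t) - freeEnergy S.h S.H T (S.systemDensity U A k 0)

/-- The work `∫ f(q,s) · q' ds` that the external force does up to time `t` on the trajectory
that starts at `z` at time `0`. -/
def work (t : ℝ) (z : PhaseSpace n × PhaseSpace m) : ℝ :=
  ∫ s in (0 : ℝ)..t, inner ℝ (S.force (U 0 s z).1.1 s) (S.hamiltonField s (U 0 s z)).1.1

/-- The average work up to time `t`. -/
def averageWork (A : ι) (k : ℤ) (t : ℝ) : ℝ :=
  ∫ z, S.work U t z * S.initialDensity A k z ∂S.jointMeasure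

/-- Average work minus change of the free energy, at time `t`. -/
def excessWork (T : ℝ) (A : ι) (k : ℤ) (t : ℝ) : ℝ :=
  S.averageWork U A k t - S.freeEnergyChange U T A k t

/-- Probability that at time `t` the system is in cell `B` and the bath in shell `j`. -/
def jointProb (A : ι) (k : ℤ) (t : ℝ) (B : ι) (j : ℤ) : ℝ :=
  ∫ z in S.cellSet B ×ˢ S.shellSet j, S.density U A k t z ∂S.jointMeasure

/-- Probability that at time `t` the system is in cell `B`. -/
def cellProb (A : ι) (k : ℤ) (t : ℝ) (B : ι) : ℝ :=
  ∫ z in S.cellSet B ×ˢ Set.univ, S.density U A k t z ∂S.jointMeasure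

/-- Conditional Shannon entropy of the energy shell of the bath given the Boltzmann cell of the
system, at time `t`. It is zero if and only if for each Boltzmann cell that the system can be in
the bath is in one Boltzmann state. -/
def bathCondEntropy (A : ι) (k : ℤ) (t : ℝ) : ℝ≥0∞ :=
  ∑' b : ι × ℤ, ENNReal.ofReal (S.cellProb U A k t b.1 *
    Real.negMulLog (S.jointProb U A k t b.1 b.2 / S.cellProb U A k t b.1))

/-- The work, the energy and the entropy that enter the average work and the free energy have
finite averages at all times. -/
structure FiniteAverages (A : ι) (k : ℤ) : Prop where
  work : ∀ t, 0 ≤ t →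
    Integrable (fun z => S.work U t z * S.initialDensity A k z) S.jointMeasure
  energy : ∀ t, 0 ≤ t →
    Integrable (fun x => S.systemDensity U A k t x * S.H x) (liouville S.h n)
  entropy : ∀ t, 0 ≤ t →
    Integrable (fun x => S.systemDensity U A k t x * Real.log (S.systemDensity U A k t x))
      (liouville S.h n)

/-- Standard assumptions on system and bath: the energy of the system is resolved by its cells up
to `ε`, the interaction energy is at most `δ`, and the bath is ideal with temperature `T` and
stays in thermal equilibrium, i.e. given the Boltzmann cell of the system it is in one Boltzmann
state, up to the conditional entropy `η t` at time `t`. -/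
structure Thermostated (T ε δ : ℝ) (η : ℝ → ℝ≥0) (A : ι) (k : ℤ) : Prop where
  energy_resolution : ∀ x x', S.cell x = S.cell x' → |S.H x - S.H x'| ≤ ε
  weak_interaction : ∀ z, |S.Hint z| ≤ δ
  ideal_bath : S.IdealBath T
  bath_equilibrium : ∀ t, 0 ≤ t → S.bathCondEntropy U A k t ≤ η t

/-- The accessible phase space volume is finite: there is a set of finite volume outside of which
the densities `C U(τ,t+τ) C U(0,τ) ρ₀` vanish, where `ρ₀` is the initial density. For `τ = 0` these
are the coarse-grained densities at time `t`. -/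
def FiniteAccessibleVolume (A : ι) (k : ℤ) : Prop :=
  ∃ K : Set (PhaseSpace n × PhaseSpace m), MeasurableSet K ∧ S.jointMeasure K < ∞ ∧
    ∀ t τ : ℝ, 0 ≤ t → 0 ≤ τ → ∀ z, z ∉ K →
      coarseGrain S.jointMeasure S.jointCell (evolveDensity U τ (t + τ)
        (coarseGrain S.jointMeasure S.jointCell (S.density U A k τ))) z = 0

end DrivenSystemWithBath

end

/-! The whole is an isolated mechanical system apart from the external force, so the work done on a
trajectory is the change of `Htot` along it (`IsEvolution.work_eq`), and the average work is a
difference of mean total energies (`averageWork_eq`). The mean energy splits into the parts of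
system, bath and interaction. The entropy of the coarse-grained density of the whole splits by the
chain rule into the entropy of the Boltzmann cell, the conditional entropy of the shell given the
cell, and the mean Boltzmann entropy of the shell (`entropy_decomposition`). For an ideal bath this
last term is the bath energy divided by `T`, up to a constant and the shell width. Eliminating the
bath energy from the two balances shows that the excess work grows by at least `T` times the growth
of the entropy of the whole, up to the tolerances (`excessWork_le`). All three claims thus reduce to
lower bounds on that entropy growth.

For the first claim, Liouville's theorem (`IsFlow.measurePreserving`) normalises the evolved
density, and neither evolution nor averaging can raise it above its initial constant value. Its
entropy is therefore at least the logarithm of the initial volume, without any mixing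
(`jointEntropy_zero_le`).

For the second, evolution preserves fine-grained entropy and averaging over cells increases it by
Jensen's inequality (`jointEntropy_le_coarseGrain_evolve`). Local mixing says that the
coarse-grained density at the later time arises from the one at the earlier time by exactly these
two operations.

For the third, the two densities are only close in L¹. On a set of finite volume, with a common
bound on the densities, this makes their entropies close (`exists_abs_negMulLog_sub_le`).

Liouville's theorem is proved for C¹ fields without establishing that the flow is differentiable
everywhere. The flow is locally Lipschitz, hence differentiable almost everywhere; its derivative
over a short time is known to first order, and vanishing divergence makes the rate of change of
volume zero. -/

/-! ### First-order behaviour of the determinant at the identity -/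

section Det

variable {E : Type*} [NormedAddCommGroup E] [NormedSpace ℝ E] [FiniteDimensional ℝ E]

/-- The trace as a continuous linear form on endomorphisms. -/
noncomputable def traceCLM (E : Type*) [NormedAddCommGroup E] [NormedSpace ℝ E]
    [FiniteDimensional ℝ E] : (E →L[ℝ] E) →L[ℝ] ℝ :=
  LinearMap.toContinuousLinearMap
    ((LinearMap.trace ℝ E).comp (ContinuousLinearMap.coeLM ℝ : (E →L[ℝ] E) →ₗ[ℝ] (E →ₗ[ℝ] E)))

@[simp] lemma traceCLM_apply (A : E →L[ℝ] E) :
    traceCLM E A = LinearMap.trace ℝ E (A : E →ₗ[ℝ] E) := rfl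

/-- The determinant is polynomial in the matrix entries, hence differentiable. Its derivative in a
direction `A` is then read off from the expansion of det(1 + rA) in the single variable r, whose
linear coefficient is the trace. -/
lemma hasFDerivAt_det_one :
    HasFDerivAt (fun A : E →L[ℝ] E => A.det) (traceCLM E) 1 := by
  classical
  let b := Module.finBasis ℝ E
  let m : (E →L[ℝ] E) →ₗ[ℝ] Matrix (Fin (Module.finrank ℝ E)) (Fin (Module.finrank ℝ E)) ℝ :=
    (LinearMap.toMatrix b b).toLinearMap.comp
      (ContinuousLinearMap.coeLM ℝ : (E →L[ℝ] E) →ₗ[ℝ] (E →ₗ[ℝ] E))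
  have hm1 : m 1 = 1 := by
    simp only [m, LinearMap.comp_apply, LinearEquiv.coe_coe]
    exact LinearMap.toMatrix_id b
  have hdet : ∀ A : E →L[ℝ] E, A.det = (m A).det := fun A => (LinearMap.det_toMatrix b _).symm
  have htr : ∀ A : E →L[ℝ] E, traceCLM E A = (m A).trace := fun A =>
    LinearMap.trace_eq_matrix_trace ℝ b _
  have hent : ∀ i j, Differentiable ℝ (fun A : E →L[ℝ] E => m A i j) := fun i j => by
    let l : (E →L[ℝ] E) →ₗ[ℝ] ℝ := (Matrix.entryLinearMap ℝ ℝ i j).comp m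
    exact (LinearMap.toContinuousLinearMap l).differentiable
  have hdiff : Differentiable ℝ (fun A : E →L[ℝ] E => A.det) := by
    simp only [hdet, Matrix.det_apply']
    refine Differentiable.fun_sum fun σ _ => ?_
    refine (differentiable_const _).mul ?_
    exact fun A => (HasFDerivAt.finsetProd fun i _ => (hent (σ i) i A).hasFDerivAt).differentiableAt
  have h1 := (hdiff 1).hasFDerivAt
  convert! h1 using 1
  ext A
  have hl : HasDerivAt (fun r : ℝ => (1 : E →L[ℝ] E) + r • A) A 0 := by
    simpa using ((hasDerivAt_id (0 : ℝ)).smul_const A).const_add 1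
  have h2 : HasDerivAt (fun r : ℝ => ((1 : E →L[ℝ] E) + r • A).det)
      (fderiv ℝ (fun A : E →L[ℝ] E => A.det) 1 A) 0 := by
    have h1' : HasFDerivAt (fun A : E →L[ℝ] E => A.det)
      (fderiv ℝ (fun A : E →L[ℝ] E => A.det) 1) ((1 : E →L[ℝ] E) + (0 : ℝ) • A) := by simpa using h1
    exact h1'.comp_hasDerivAt (0 : ℝ) hl
  have h3 : HasDerivAt (fun r : ℝ => ((1 : E →L[ℝ] E) + r • A).det) (m A).trace 0 := by
    have hp : (fun r : ℝ => ((1 : E →L[ℝ] E) + r • A).det) = fun r =>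
        1 + (m A).trace * r +
          ((Matrix.det (1 + (Polynomial.X : Polynomial ℝ) • (m A).map Polynomial.C)).divX.divX).eval
            r * r ^ 2 := by
      funext r
      rw [hdet, map_add, map_smul, hm1, Matrix.det_one_add_smul]
    rw [hp]
    set P := (Matrix.det (1 + (Polynomial.X : Polynomial ℝ) • (m A).map Polynomial.C)).divX.divX
    have := (((hasDerivAt_id (0 : ℝ)).const_mul (m A).trace).const_add 1).add
      ((P.hasDerivAt 0).mul ((hasDerivAt_id (0 : ℝ)).pow 2))
    convert! this using 1
    simp
  rw [htr, h3.unique h2]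

/-- A linear map that agrees to first order with `1 + h A`, where `A` has trace zero, has
determinant one to first order, uniformly in `A`. -/
lemma exists_abs_abs_det_sub_one_le (M : ℝ) {ε : ℝ} (hε : 0 < ε) :
    ∃ h₀ > 0, ∃ η > 0, ∀ (A D : E →L[ℝ] E) (h : ℝ), ‖A‖ ≤ M →
      LinearMap.trace ℝ E (A : E →ₗ[ℝ] E) = 0 → 0 < h → h ≤ h₀ →
      ‖D - 1 - h • A‖ ≤ η * h → |(|D.det| - 1)| ≤ ε * h := by
  set N := ‖traceCLM E‖
  have hN : 0 ≤ N := norm_nonneg (traceCLM E)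
  set M' := |M| + 1
  have hM' : 0 < M' := by positivity
  have hlo := (hasFDerivAt_det_one (E := E)).isLittleO
  rw [Asymptotics.isLittleO_iff] at hlo
  have hc : 0 < ε / (2 * M') := by positivity
  obtain ⟨r, hr, hball⟩ := Metric.eventually_nhds_iff.1 (hlo hc)
  -- The bound 1 on `η` gives ‖D - 1‖ ≤ M' h, which the bound on h keeps below `r`. The second bound
  -- on `η` makes the trace of the error at most ε h / 2; the remainder of the determinant takes the
  -- other half.
  refine ⟨r / (2 * M'), by positivity, min 1 (ε / (2 * (N + 1))), by positivity, ?_⟩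
  intro A D h hA htr h0 hh hD
  have hη1 : ‖D - 1 - h • A‖ ≤ h := hD.trans
    (by nlinarith [min_le_left 1 (ε / (2 * (N + 1)))])
  have hη2 : ‖D - 1 - h • A‖ ≤ ε / (2 * (N + 1)) * h := hD.trans
    (by nlinarith [min_le_right 1 (ε / (2 * (N + 1)))])
  have hB : ‖D - 1‖ ≤ M' * h := by
    have h1 : D - 1 = (D - 1 - h • A) + h • A := by abel
    rw [h1]
    refine (norm_add_le _ _).trans ?_
    have h2 : ‖h • A‖ ≤ h * |M| := by
      rw [norm_smul, Real.norm_of_nonneg h0.le]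
      exact mul_le_mul_of_nonneg_left (hA.trans (le_abs_self M)) h0.le
    simp only [M']
    linarith
  have hDr : dist D 1 < r := by
    rw [dist_eq_norm]
    refine hB.trans_lt ?_
    have : M' * h ≤ M' * (r / (2 * M')) := mul_le_mul_of_nonneg_left hh hM'.le
    have h4 : M' * (r / (2 * M')) = r / 2 := by field_simp
    linarith
  have h5 := hball hDr
  have hone : (1 : E →L[ℝ] E).det = 1 := by
    exact LinearMap.det_id
  have htrD : |traceCLM E (D - 1)| ≤ ε / 2 * h := by
    have h6 : traceCLM E (D - 1) = traceCLM E (D - 1 - h • A) := by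
      rw [map_sub (traceCLM E) (D - 1), map_smul, traceCLM_apply A, htr]
      simp
    rw [h6]
    refine ((traceCLM E).le_opNorm _).trans ?_
    calc N * ‖D - 1 - h • A‖ ≤ (N + 1) * (ε / (2 * (N + 1)) * h) := by
          gcongr; linarith
      _ = ε / 2 * h := by field_simp
  have h7 : |D.det - 1 - traceCLM E (D - 1)| ≤ ε / 2 * h := by
    rw [hone] at h5
    refine h5.trans ?_
    calc ε / (2 * M') * ‖D - 1‖ ≤ ε / (2 * M') * (M' * h) := by gcongr
      _ = ε / 2 * h := by field_simp
  have h8 : |(|D.det| - 1)| ≤ |D.det - 1| := by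
    simpa using abs_abs_sub_abs_le D.det 1
  refine h8.trans ?_
  have := abs_add_le (D.det - 1 - traceCLM E (D - 1)) (traceCLM E (D - 1))
  rw [sub_add_cancel] at this
  linarith

end Det

/-! ### Rademacher's theorem and null sets for locally Lipschitz maps -/

section LocallyLipschitz

variable {E : Type*} [NormedAddCommGroup E] [NormedSpace ℝ E] [FiniteDimensional ℝ E]
  [MeasurableSpace E] [BorelSpace E] (μ : Measure E) [μ.IsAddHaarMeasure]

lemma LocallyLipschitz.ae_differentiableAt {f : E → E} (hf : LocallyLipschitz f) :
    ∀ᵐ x ∂μ, DifferentiableAt ℝ f x := by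
  rw [ae_iff]
  refine measure_null_of_locally_null _ fun x _ => ?_
  obtain ⟨K, t, ht, hK⟩ := hf x
  refine ⟨interior t ∩ {a | ¬DifferentiableAt ℝ f a}, ?_, ?_⟩
  · rw [Set.inter_comm]
    exact inter_mem_nhdsWithin _ (interior_mem_nhds.2 ht)
  · have := (hK.mono interior_subset).ae_differentiableWithinAt (μ := μ)
      isOpen_interior.measurableSet
    rw [ae_restrict_iff' isOpen_interior.measurableSet, ae_iff] at this
    refine measure_mono_null (fun y hy => ?_) this
    simp only [Set.mem_ofPred_eq, Classical.not_imp]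
    exact ⟨hy.1, fun h => hy.2 (h.differentiableAt (isOpen_interior.mem_nhds hy.1))⟩

/-- Haar measure has the same null sets as Hausdorff measure of full dimension, and a Lipschitz map
enlarges the latter by a bounded factor. Countably many neighbourhoods with a Lipschitz bound cover
the space. -/
lemma LocallyLipschitz.addHaar_image_eq_zero {f : E → E} (hf : LocallyLipschitz f) {s : Set E}
    (hs : μ s = 0) : μ (f '' s) = 0 := by
  have hac : μ ≪ Measure.hausdorffMeasure (Module.finrank ℝ E : ℝ) :=
    Measure.absolutelyContinuous_isAddHaarMeasure _ _
  have hca : Measure.hausdorffMeasure (Module.finrank ℝ E : ℝ) ≪ μ :=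
    Measure.absolutelyContinuous_isAddHaarMeasure _ _
  choose K t ht hK using hf
  obtain ⟨c, hc, hcov⟩ := TopologicalSpace.countable_cover_nhds ht
  have hsub : f '' s ⊆ ⋃ x ∈ c, f '' (s ∩ t x) := by
    rintro _ ⟨y, hy, rfl⟩
    have : y ∈ ⋃ x ∈ c, t x := hcov ▸ Set.mem_univ y
    simp only [Set.mem_iUnion] at this ⊢
    obtain ⟨x, hx, hyx⟩ := this
    exact ⟨x, hx, y, ⟨hy, hyx⟩, rfl⟩
  refine measure_mono_null hsub ((measure_biUnion_null_iff hc).2 fun x _ => hac ?_)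
  have h0 : Measure.hausdorffMeasure (Module.finrank ℝ E : ℝ) (s ∩ t x) = 0 :=
    hca (measure_mono_null Set.inter_subset_left hs)
  have := ((hK x).mono (Set.inter_subset_right (s := s))).hausdorffMeasure_image_le
    (d := (Module.finrank ℝ E : ℝ)) (by positivity)
  rw [h0, mul_zero] at this
  exact le_antisymm this zero_le

end LocallyLipschitz

/-! ### Evolution of a C¹ time-dependent field: stability and composition law -/

section Flow

variable {E : Type*} [NormedAddCommGroup E] [NormedSpace ℝ E]

/-- `U` is the evolution of the ordinary differential equation `x' = F t x` on non-negative
times. -/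
structure IsFlow (F : ℝ → E → E) (U : ℝ → ℝ → E → E) : Prop where
  init : ∀ s, 0 ≤ s → ∀ z, U s s z = z
  deriv : ∀ s, 0 ≤ s → ∀ z t, 0 ≤ t →
    HasDerivWithinAt (fun r => U s r z) (F t (U s t z)) (Set.Ici 0) t

section Field

variable {F : ℝ → E → E}

lemma differentiable_slice (hF : ContDiff ℝ 1 (fun p : ℝ × E => F p.1 p.2)) (t : ℝ) :
    Differentiable ℝ (F t) :=
  (hF.differentiable one_ne_zero).comp (differentiable_const t |>.prodMk differentiable_id)

lemma continuous_fderiv_slice (hF : ContDiff ℝ 1 (fun p : ℝ × E => F p.1 p.2)) :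
    Continuous (fun p : ℝ × E => fderiv ℝ (F p.1) p.2) := by
  have h : (fun p : ℝ × E => fderiv ℝ (F p.1) p.2) = fun p =>
      (fderiv ℝ (fun p : ℝ × E => F p.1 p.2) p).comp (ContinuousLinearMap.inr ℝ ℝ E) := by
    funext p
    have h1 : HasFDerivAt (fun p : ℝ × E => F p.1 p.2)
        (fderiv ℝ (fun p : ℝ × E => F p.1 p.2) p) (p.1, p.2) :=
      (hF.differentiable one_ne_zero p).hasFDerivAt
    have h2 : HasFDerivAt (fun x : E => (p.1, x)) (ContinuousLinearMap.inr ℝ ℝ E) p.2 :=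
      hasFDerivAt_prodMk_right p.1 p.2
    exact (h1.comp p.2 h2).fderiv
  rw [h]
  exact (hF.continuous_fderiv one_ne_zero).clm_comp continuous_const

lemma lipschitzOnWith_slice (hF : ContDiff ℝ 1 (fun p : ℝ × E => F p.1 p.2)) {T R : ℝ} {K : ℝ≥0}
    (hK : ∀ r ∈ Set.Icc 0 T, ∀ x ∈ Metric.closedBall (0 : E) R, ‖fderiv ℝ (F r) x‖ ≤ K)
    {r : ℝ} (hr : r ∈ Set.Icc 0 T) : LipschitzOnWith K (F r) (Metric.closedBall 0 R) :=
  (convex_closedBall 0 R).lipschitzOnWith_of_nnnorm_fderiv_le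
    (fun x _ => differentiable_slice hF r x) (fun x hx => hK r hr x hx)

variable [FiniteDimensional ℝ E]

lemma exists_norm_fderiv_slice_le (hF : ContDiff ℝ 1 (fun p : ℝ × E => F p.1 p.2)) (T R : ℝ) :
    ∃ K : ℝ≥0, ∀ r ∈ Set.Icc 0 T, ∀ x ∈ Metric.closedBall (0 : E) R,
      ‖fderiv ℝ (F r) x‖ ≤ K := by
  have hc : IsCompact (Set.Icc 0 T ×ˢ Metric.closedBall (0 : E) R) :=
    isCompact_Icc.prod (isCompact_closedBall _ _)
  obtain ⟨C, hC⟩ := hc.exists_bound_of_continuousOn (continuous_fderiv_slice hF).continuousOn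
  refine ⟨C.toNNReal, fun r hr x hx => (hC (r, x) ⟨hr, hx⟩).trans ?_⟩
  exact Real.le_coe_toNNReal C

end Field

namespace IsFlow

variable {F : ℝ → E → E} {U : ℝ → ℝ → E → E}

lemma continuousOn (hU : IsFlow F U) {s : ℝ} (hs : 0 ≤ s) (z : E) :
    ContinuousOn (fun r => U s r z) (Set.Ici 0) :=
  fun t ht => (hU.deriv s hs z t ht).continuousWithinAt

lemma exists_bound (hU : IsFlow F U) {s : ℝ} (hs : 0 ≤ s) (z : E) (T : ℝ) :
    ∃ R : ℝ, ∀ r ∈ Set.Icc 0 T, ‖U s r z‖ ≤ R :=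
  isCompact_Icc.exists_bound_of_continuousOn
    ((hU.continuousOn hs z).mono fun _ h => h.1)

lemma derivRight (hU : IsFlow F U) {s : ℝ} (hs : 0 ≤ s) (z : E) {t : ℝ} (ht : 0 ≤ t) :
    HasDerivWithinAt (fun r => U s r z) (F t (U s t z)) (Set.Ici t) t :=
  (hU.deriv s hs z t ht).mono fun _ hx => ht.trans hx

/-- A trajectory that starts close to one that stays in a ball remains close to it. -/
lemma norm_sub_le (hU : IsFlow F U) (hF : ContDiff ℝ 1 (fun p : ℝ × E => F p.1 p.2))
    {T R : ℝ} {K : ℝ≥0}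
    (hK : ∀ r ∈ Set.Icc 0 T, ∀ x ∈ Metric.closedBall (0 : E) (R + 1), ‖fderiv ℝ (F r) x‖ ≤ K)
    {s t : ℝ} (hs : 0 ≤ s) (htT : t ≤ T) {x y : E} (hx : ∀ r ∈ Set.Icc s t, ‖U s r x‖ ≤ R)
    {d : ℝ} (hd : 0 < d) (hd1 : d * Real.exp ((K + 1) * (t - s)) ≤ 1) (hxy : ‖y - x‖ ≤ d) :
    ∀ r ∈ Set.Icc s t, ‖U s r y - U s r x‖ ≤ d * Real.exp ((K + 1) * (r - s)) := by
  have hB : ∀ r : ℝ, HasDerivAt (fun r => d * Real.exp ((K + 1) * (r - s)))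
      ((K + 1) * (d * Real.exp ((K + 1) * (r - s)))) r := fun r => by
    have h1 : HasDerivAt (fun r : ℝ => ((K : ℝ) + 1) * (r - s)) ((K : ℝ) + 1) r := by
      simpa using ((hasDerivAt_id r).sub_const s).const_mul ((K : ℝ) + 1)
    exact (h1.exp.const_mul d).congr_deriv (by ring)
  -- Barrier argument: the difference cannot cross d exp((K+1)(r-s)). At a contact the barrier is at
  -- most 1, so both points lie in the ball of radius `R + 1`, where the Lipschitz constant is `K`.
  -- The rate `K + 1` instead of `K` makes the comparison of slopes strict.
  refine image_norm_le_of_norm_deriv_right_lt_deriv_boundary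
    (f' := fun r => F r (U s r y) - F r (U s r x))
    (((hU.continuousOn hs y).mono fun r hr => hs.trans hr.1).sub
      ((hU.continuousOn hs x).mono fun r hr => hs.trans hr.1))
    (fun r hr => (((hU.deriv s hs y r (hs.trans hr.1)).sub
      (hU.deriv s hs x r (hs.trans hr.1))).mono fun q hq => (hs.trans hr.1).trans hq))
    ?_ hB ?_
  · simpa [hU.init s hs] using hxy
  · intro r hr heq
    simp only [Pi.sub_apply] at heq
    have hr0 : r ∈ Set.Icc 0 T := ⟨hs.trans hr.1, hr.2.le.trans htT⟩
    have hxR : ‖U s r x‖ ≤ R := hx r ⟨hr.1, hr.2.le⟩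
    have hle1 : ‖U s r y - U s r x‖ ≤ 1 := by
      rw [heq]
      refine le_trans ?_ hd1
      gcongr
      exact hr.2.le
    have hyR : ‖U s r y‖ ≤ R + 1 := by
      have := norm_add_le (U s r y - U s r x) (U s r x)
      rw [sub_add_cancel] at this
      linarith
    have hlip := (lipschitzOnWith_slice hF hK hr0).norm_sub_le
      (x := U s r y) (y := U s r x) (by simpa using hyR) (by simp; linarith)
    have hpos : 0 < ‖U s r y - U s r x‖ := by rw [heq]; positivity
    simp only [← heq]
    nlinarith

variable [FiniteDimensional ℝ E]

/-- Both sides solve the same equation in the final time and agree at time `t`. On a bounded time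
interval they stay in a ball where the field is Lipschitz, so uniqueness applies, forwards or
backwards from `t`. -/
lemma comp_apply (hU : IsFlow F U) (hF : ContDiff ℝ 1 (fun p : ℝ × E => F p.1 p.2))
    {s t r : ℝ} (hs : 0 ≤ s) (ht : 0 ≤ t) (hr : 0 ≤ r) (z : E) :
    U t r (U s t z) = U s r z := by
  set T := max t r
  obtain ⟨R₁, hR₁⟩ := hU.exists_bound ht (U s t z) T
  obtain ⟨R₂, hR₂⟩ := hU.exists_bound hs z T
  set R := max R₁ R₂
  obtain ⟨K, hK⟩ := exists_norm_fderiv_slice_le hF T R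
  have hmem₁ : ∀ q ∈ Set.Icc 0 T, U t q (U s t z) ∈ Metric.closedBall (0 : E) R := fun q hq =>
    mem_closedBall_zero_iff.2 ((hR₁ q hq).trans (le_max_left _ _))
  have hmem₂ : ∀ q ∈ Set.Icc 0 T, U s q z ∈ Metric.closedBall (0 : E) R := fun q hq =>
    mem_closedBall_zero_iff.2 ((hR₂ q hq).trans (le_max_right _ _))
  have h0 : U t t (U s t z) = U s t z := hU.init t ht _
  rcases le_total t r with htr | hrt
  · have hTr : T = r := max_eq_right htr
    have hsub : ∀ q, q ∈ Set.Ico t r → q ∈ Set.Icc 0 T := fun q hq =>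
      ⟨ht.trans hq.1, hTr ▸ hq.2.le⟩
    exact ODE_solution_unique_of_mem_Icc_right (v := F) (s := fun _ => Metric.closedBall 0 R)
      (a := t) (b := r)
      (f := fun q => U t q (U s t z)) (g := fun q => U s q z)
      (fun q hq => lipschitzOnWith_slice hF hK (hsub q hq))
      ((hU.continuousOn ht _).mono fun q hq => ht.trans hq.1)
      (fun q hq => (hU.deriv t ht _ q (ht.trans hq.1)).mono fun x hx => (ht.trans hq.1).trans hx)
      (fun q hq => hmem₁ q (hsub q hq))
      ((hU.continuousOn hs _).mono fun q hq => ht.trans hq.1)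
      (fun q hq => (hU.deriv s hs _ q (ht.trans hq.1)).mono fun x hx => (ht.trans hq.1).trans hx)
      (fun q hq => hmem₂ q (hsub q hq)) h0 (Set.right_mem_Icc.2 htr)
  · have hTr : T = t := max_eq_left hrt
    have hsub : ∀ q, q ∈ Set.Ioc r t → q ∈ Set.Icc 0 T := fun q hq =>
      ⟨hr.trans hq.1.le, hTr ▸ hq.2⟩
    -- The differential equation is only assumed within the non-negative times. Away from the left
    -- end point the time is positive, so the derivative is two-sided there.
    have hnhds : ∀ q, q ∈ Set.Ioc r t → Set.Ici (0 : ℝ) ∈ 𝓝 q := fun q hq =>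
      Ici_mem_nhds (hr.trans_lt hq.1)
    exact ODE_solution_unique_of_mem_Icc_left (v := F) (s := fun _ => Metric.closedBall 0 R)
      (a := r) (b := t)
      (f := fun q => U t q (U s t z)) (g := fun q => U s q z)
      (fun q hq => lipschitzOnWith_slice hF hK (hsub q hq))
      ((hU.continuousOn ht _).mono fun q hq => hr.trans hq.1)
      (fun q hq => ((hU.deriv t ht _ q (hr.trans hq.1.le)).hasDerivAt
        (hnhds q hq)).hasDerivWithinAt)
      (fun q hq => hmem₁ q (hsub q hq))
      ((hU.continuousOn hs _).mono fun q hq => hr.trans hq.1)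
      (fun q hq => ((hU.deriv s hs _ q (hr.trans hq.1.le)).hasDerivAt
        (hnhds q hq)).hasDerivWithinAt)
      (fun q hq => hmem₂ q (hsub q hq)) h0 (Set.left_mem_Icc.2 hrt)

lemma leftInverse (hU : IsFlow F U) (hF : ContDiff ℝ 1 (fun p : ℝ × E => F p.1 p.2))
    {s t : ℝ} (hs : 0 ≤ s) (ht : 0 ≤ t) : Function.LeftInverse (U t s) (U s t) := fun z => by
  rw [hU.comp_apply hF hs ht hs, hU.init s hs]

end IsFlow

end Flow

/-! ### Dependence of the evolution on the initial point -/

section Flow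

variable {E : Type*} [NormedAddCommGroup E] [NormedSpace ℝ E] [FiniteDimensional ℝ E]

namespace IsFlow

variable {F : ℝ → E → E} {U : ℝ → ℝ → E → E}

/-- Trajectories starting near `x` stay, up to time `t`, within distance 1 of the one of `x`, hence
in a ball on which the field has a Lipschitz constant. Grönwall's inequality there bounds all the
maps with one constant. -/
lemma locallyLipschitz_uniform (hU : IsFlow F U) (hF : ContDiff ℝ 1 (fun p : ℝ × E => F p.1 p.2))
    {s t : ℝ} (hs : 0 ≤ s) (x : E) :
    ∃ K : ℝ≥0, ∃ d > 0, ∀ r ∈ Set.Icc s t, LipschitzOnWith K (U s r) (Metric.closedBall x d) := by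
  obtain ⟨R, hR⟩ := hU.exists_bound hs x t
  obtain ⟨K, hK⟩ := exists_norm_fderiv_slice_le hF t (R + 1)
  set d := Real.exp (-((K + 1) * (t - s)))
  have hd : 0 < d := Real.exp_pos _
  have hd1 : d * Real.exp ((K + 1) * (t - s)) = 1 := by
    simp only [d]; rw [← Real.exp_add]; simp
  have hball : ∀ y ∈ Metric.closedBall x d, ∀ r ∈ Set.Icc s t,
      U s r y ∈ Metric.closedBall (0 : E) (R + 1) := fun y hy r hr => by
    rw [mem_closedBall_zero_iff]
    have h1 := hU.norm_sub_le hF hK hs le_rfl (fun q hq => hR q ⟨hs.trans hq.1, hq.2⟩) hd hd1.le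
      (mem_closedBall_iff_norm.1 hy) r hr
    have h2 : d * Real.exp ((K + 1) * (r - s)) ≤ 1 :=
      (mul_le_mul_of_nonneg_left (Real.exp_le_exp.2 (mul_le_mul_of_nonneg_left
        (by linarith [hr.2]) (by positivity))) hd.le).trans hd1.le
    have h3 := norm_add_le (U s r y - U s r x) (U s r x)
    rw [sub_add_cancel] at h3
    have := hR r ⟨hs.trans hr.1, hr.2⟩
    linarith
  refine ⟨(Real.exp (K * (t - s))).toNNReal, d, hd, fun r hr => ?_⟩
  refine LipschitzOnWith.of_dist_le_mul fun y hy z hz => ?_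
  rw [Real.coe_toNNReal _ (Real.exp_pos _).le, mul_comm]
  have := dist_le_of_trajectories_ODE_of_mem (v := F)
    (s := fun _ => Metric.closedBall (0 : E) (R + 1)) (K := K)
    (f := fun r => U s r y) (g := fun r => U s r z) (a := s) (b := t) (δ := dist y z)
    (fun q hq => lipschitzOnWith_slice hF hK ⟨hs.trans hq.1, hq.2.le⟩)
    ((hU.continuousOn hs _).mono fun q hq => hs.trans hq.1)
    (fun q hq => hU.derivRight hs _ (hs.trans hq.1))
    (fun q hq => hball y hy q ⟨hq.1, hq.2.le⟩)
    ((hU.continuousOn hs _).mono fun q hq => hs.trans hq.1)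
    (fun q hq => hU.derivRight hs _ (hs.trans hq.1))
    (fun q hq => hball z hz q ⟨hq.1, hq.2.le⟩)
    (by simp [hU.init s hs]) r hr
  refine this.trans ?_
  gcongr
  exact hr.2

lemma locallyLipschitz (hU : IsFlow F U) (hF : ContDiff ℝ 1 (fun p : ℝ × E => F p.1 p.2))
    {s t : ℝ} (hs : 0 ≤ s) (hst : s ≤ t) : LocallyLipschitz (U s t) := fun x => by
  obtain ⟨K, d, hd, h⟩ := hU.locallyLipschitz_uniform hF (t := t) hs x
  exact ⟨K, _, Metric.closedBall_mem_nhds x hd, h t (Set.right_mem_Icc.2 hst)⟩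

/-- The trajectories that start in a compact set remain bounded on bounded time intervals. -/
lemma exists_bound_of_isCompact (hU : IsFlow F U)
    (hF : ContDiff ℝ 1 (fun p : ℝ × E => F p.1 p.2)) {S : Set E} (hS : IsCompact S) (T : ℝ) :
    ∃ R : ℝ, ∀ x ∈ S, ∀ r ∈ Set.Icc 0 T, ‖U 0 r x‖ ≤ R := by
  refine hS.induction_on (p := fun S => ∃ R : ℝ, ∀ x ∈ S, ∀ r ∈ Set.Icc 0 T, ‖U 0 r x‖ ≤ R)
    ⟨0, by simp⟩ ?_ ?_ ?_
  · rintro s t hst ⟨R, hR⟩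
    exact ⟨R, fun x hx => hR x (hst hx)⟩
  · rintro s t ⟨R, hR⟩ ⟨R', hR'⟩
    refine ⟨max R R', ?_⟩
    rintro x (hx | hx) r hr
    · exact (hR x hx r hr).trans (le_max_left _ _)
    · exact (hR' x hx r hr).trans (le_max_right _ _)
  · intro x _
    obtain ⟨K, d, hd, h⟩ := hU.locallyLipschitz_uniform hF (t := T) le_rfl x
    obtain ⟨R, hR⟩ := hU.exists_bound le_rfl x T
    refine ⟨Metric.closedBall x d, mem_nhdsWithin_of_mem_nhds (Metric.closedBall_mem_nhds x hd),
      R + K * d, fun y hy r hr => ?_⟩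
    have h1 := (h r hr).norm_sub_le hy (Metric.mem_closedBall_self hd.le)
    have h2 := norm_add_le (U 0 r y - U 0 r x) (U 0 r x)
    rw [sub_add_cancel] at h2
    have h3 := hR r hr
    have h4 : (K : ℝ) * ‖y - x‖ ≤ K * d :=
      mul_le_mul_of_nonneg_left (mem_closedBall_iff_norm.1 hy) K.2
    linarith

/-- The spatial derivative of the evolution over a short time interval is known to first order,
uniformly on bounded sets. -/
lemma exists_norm_fderiv_sub_le (hU : IsFlow F U)
    (hF : ContDiff ℝ 1 (fun p : ℝ × E => F p.1 p.2)) (T R : ℝ) {ε : ℝ} (hε : 0 < ε) :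
    ∃ h₀ > 0, ∀ s h x, 0 ≤ s → 0 < h → h ≤ h₀ → s + h ≤ T →
      (∀ r ∈ Set.Icc s (s + h), ‖U s r x‖ ≤ R) → DifferentiableAt ℝ (U s (s + h)) x →
      ‖fderiv ℝ (U s (s + h)) x - 1 - h • fderiv ℝ (F s) x‖ ≤ ε * h := by
  obtain ⟨K, hK⟩ := exists_norm_fderiv_slice_le hF T (R + 1)
  have hcomp : IsCompact (Set.Icc 0 T ×ˢ Metric.closedBall (0 : E) (R + 1)) :=
    isCompact_Icc.prod (isCompact_closedBall _ _)
  obtain ⟨M, hM⟩ := hcomp.exists_bound_of_continuousOn hF.continuous.continuousOn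
  have huc := hcomp.uniformContinuousOn_of_continuous (continuous_fderiv_slice hF).continuousOn
  obtain ⟨η, hη, huc⟩ := Metric.uniformContinuousOn_iff.1 huc (ε / 4) (by positivity)
  set M' := |M| + 1
  have hM' : 0 < M' := by positivity
  -- The four bounds on h give, in turn, exp((K+1)h) ≤ 2, 2K²h ≤ ε/2, a displacement of the
  -- reference trajectory of at most η/2, and a time step within the modulus of continuity `η` of
  -- the spatial derivative of the field.
  refine ⟨min (min (Real.log 2 / (K + 1)) (ε / (4 * (K ^ 2 + 1))))
    (min (η / (2 * M')) (η / 2)), ?_, ?_⟩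
  · have := Real.log_pos one_lt_two
    have : (0 : ℝ) ≤ K := K.2
    positivity
  intro s h x hs h0 hh hsT hR hdiff
  have hK0 : (0 : ℝ) ≤ K := K.2
  have hh1 : h ≤ Real.log 2 / (K + 1) := hh.trans ((min_le_left _ _).trans (min_le_left _ _))
  have hh2 : h ≤ ε / (4 * (K ^ 2 + 1)) := hh.trans ((min_le_left _ _).trans (min_le_right _ _))
  have hh3 : h ≤ η / (2 * M') := hh.trans ((min_le_right _ _).trans (min_le_left _ _))
  have hh4 : h ≤ η / 2 := hh.trans ((min_le_right _ _).trans (min_le_right _ _))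
  have hexp : Real.exp ((K + 1) * h) ≤ 2 := by
    rw [← Real.le_log_iff_exp_le two_pos, mul_comm]
    exact (le_div_iff₀ (by positivity)).1 hh1
  have hK2 : 2 * (K : ℝ) ^ 2 * h ≤ ε / 2 := by
    rw [le_div_iff₀ (by positivity)] at hh2
    nlinarith
  have hMh : M' * h ≤ η / 2 := by
    rw [le_div_iff₀ (by positivity)] at hh3
    linarith
  have hIcc : ∀ r ∈ Set.Icc s (s + h), r ∈ Set.Icc 0 T := fun r hr =>
    ⟨hs.trans hr.1, hr.2.trans hsT⟩
  have hs_mem : s ∈ Set.Icc s (s + h) := ⟨le_rfl, by linarith⟩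
  have hxR : ‖x‖ ≤ R := by simpa [hU.init s hs] using hR s hs_mem
  set A := fderiv ℝ (F s) x
  have hA : ‖A‖ ≤ K := hK s (hIcc s hs_mem) x (by rw [mem_closedBall_zero_iff]; linarith)
  -- the reference trajectory stays near `x`
  have hb : ∀ r ∈ Set.Icc s (s + h), ‖U s r x - x‖ ≤ η / 2 := fun r hr => by
    have := norm_image_sub_le_of_norm_deriv_right_le_segment (f := fun r => U s r x)
      (C := M') (a := s) (b := s + h) ((hU.continuousOn hs x).mono fun q hq => hs.trans hq.1)
      (fun q hq => hU.derivRight hs x (hs.trans hq.1))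
      (fun q hq => by
        have hq' : q ∈ Set.Icc s (s + h) := ⟨hq.1, hq.2.le⟩
        have hm := hM (q, U s q x) ⟨hIcc q hq', by
          rw [mem_closedBall_zero_iff]; linarith [hR q hq']⟩
        exact hm.trans ((le_abs_self M).trans (by simp [M']))) r hr
    simp only [hU.init s hs] at this
    refine this.trans (le_trans ?_ hMh)
    exact mul_le_mul_of_nonneg_left (by linarith [hr.2]) hM'.le
  have hfd : HasFDerivAt (fun z => U s (s + h) z - z - h • A z)
      (fderiv ℝ (U s (s + h)) x - 1 - h • A) x :=
    (hdiff.hasFDerivAt.sub (hasFDerivAt_id x)).sub (A.hasFDerivAt.const_smul h)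
  -- The norm of a derivative is bounded by a Lipschitz bound at the point `x`, so only a difference
  -- of two trajectories has to be estimated and no variational equation is needed.
  refine hfd.le_of_lip' (by positivity) ?_
  -- With the growth factor 2, the bound 1/2 keeps the two trajectories within distance 1, and η/4
  -- keeps the second one within η of `x`.
  have hnear : ∀ᶠ y in 𝓝 x, ‖y - x‖ < min (1 / 2) (η / 4) := by
    filter_upwards [Metric.ball_mem_nhds x (show 0 < min (1 / 2) (η / 4) by positivity)] with y hy
    exact mem_ball_iff_norm.1 hy
  filter_upwards [hnear] with y hy
  have hy1 : ‖y - x‖ < 1 / 2 := hy.trans_le (min_le_left _ _)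
  have hy2 : ‖y - x‖ < η / 4 := hy.trans_le (min_le_right _ _)
  rcases eq_or_ne y x with rfl | hne
  · simp
  have hpos : 0 < ‖y - x‖ := norm_pos_iff.2 (sub_ne_zero.2 hne)
  have hab : ∀ r ∈ Set.Icc s (s + h), ‖U s r y - U s r x‖ ≤ 2 * ‖y - x‖ := fun r hr => by
    have h1 := hU.norm_sub_le hF hK hs hsT hR hpos (by
      rw [add_sub_cancel_left]; nlinarith) le_rfl r hr
    have h2 : Real.exp ((K + 1) * (r - s)) ≤ 2 := by
      refine le_trans ?_ hexp
      gcongr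
      linarith [hr.2]
    nlinarith
  have hderiv : ∀ r, s ≤ r → HasDerivWithinAt (fun r => U s r y - U s r x)
      (F r (U s r y) - F r (U s r x)) (Set.Ici r) r := fun r hr =>
    (hU.derivRight hs y (hs.trans hr)).sub (hU.derivRight hs x (hs.trans hr))
  have hcont : ContinuousOn (fun r => U s r y - U s r x) (Set.Icc s (s + h)) :=
    ((hU.continuousOn hs y).mono fun r hr => hs.trans hr.1).sub
      ((hU.continuousOn hs x).mono fun r hr => hs.trans hr.1)
  have hmemx : ∀ r ∈ Set.Icc s (s + h), U s r x ∈ Metric.closedBall (0 : E) (R + 1) :=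
    fun r hr => by rw [mem_closedBall_zero_iff]; linarith [hR r hr]
  have hmemy : ∀ r ∈ Set.Icc s (s + h), U s r y ∈ Metric.closedBall (0 : E) (R + 1) :=
    fun r hr => by
      rw [mem_closedBall_zero_iff]
      have := norm_add_le (U s r y - U s r x) (U s r x)
      rw [sub_add_cancel] at this
      linarith [hab r hr, hR r hr]
  have hv : ∀ r ∈ Set.Icc s (s + h),
      ‖U s r y - U s r x - (y - x)‖ ≤ 2 * K * h * ‖y - x‖ := fun r hr => by
    have := norm_image_sub_le_of_norm_deriv_right_le_segment (C := K * (2 * ‖y - x‖)) hcont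
      (fun q hq => hderiv q hq.1) (fun q hq => by
        have hq' : q ∈ Set.Icc s (s + h) := ⟨hq.1, hq.2.le⟩
        refine ((lipschitzOnWith_slice hF hK (hIcc q hq')).norm_sub_le
          (hmemy q hq') (hmemx q hq')).trans ?_
        exact mul_le_mul_of_nonneg_left (hab q hq') hK0) r hr
    simp only [hU.init s hs] at this
    refine this.trans ?_
    have h6 : K * (2 * ‖y - x‖) * (r - s) ≤ K * (2 * ‖y - x‖) * h :=
      mul_le_mul_of_nonneg_left (by linarith [hr.2]) (by positivity)
    linarith
  -- Mean value inequality in time after subtracting the linear prediction. The rate of the error is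
  -- at most ε‖y - x‖: one half from the oscillation of the derivative of the field, the other from
  -- the change 2Kh‖y - x‖ of the difference of the trajectories, on which `A` acts.
  have hw := norm_image_sub_le_of_norm_deriv_right_le_segment
    (f := fun r => U s r y - U s r x - (r - s) • A (y - x))
    (f' := fun r => F r (U s r y) - F r (U s r x) - A (y - x)) (C := ε * ‖y - x‖)
    (a := s) (b := s + h)
    (hcont.sub (by fun_prop))
    (fun q hq => by
      refine (hderiv q hq.1).sub ?_
      have : HasDerivAt (fun r : ℝ => (r - s) • A (y - x)) ((1 : ℝ) • A (y - x)) q :=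
        ((hasDerivAt_id q).sub_const s).smul_const _
      rw [one_smul] at this
      exact this.hasDerivWithinAt)
    (fun q hq => by
      have hq' : q ∈ Set.Icc s (s + h) := ⟨hq.1, hq.2.le⟩
      have hconv : Convex ℝ (Metric.closedBall (0 : E) (R + 1) ∩ Metric.ball x η) :=
        (convex_closedBall _ _).inter (convex_ball _ _)
      have hxη : ‖U s q x - x‖ < η := by linarith [hb q hq']
      have hyη : ‖U s q y - x‖ < η := by
        have := norm_add_le (U s q y - U s q x) (U s q x - x)
        rw [sub_add_sub_cancel] at this
        linarith [hb q hq', hab q hq']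
      have h1 := hconv.norm_image_sub_le_of_norm_fderiv_le' (𝕜 := ℝ) (f := F q) (φ := A)
        (C := ε / 4) (x := U s q x) (y := U s q y)
        (fun z _ => differentiable_slice hF q z)
        (fun z hz => by
          have := huc (q, z) ⟨hIcc q hq', hz.1⟩ (s, x) ⟨hIcc s hs_mem, by
            rw [mem_closedBall_zero_iff]; linarith⟩ (by
              rw [Prod.dist_eq, max_lt_iff]
              refine ⟨?_, hz.2⟩
              rw [Real.dist_eq, abs_of_nonneg (by linarith [hq.1])]
              linarith [hq.2])
          rw [dist_eq_norm] at this
          exact this.le)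
        ⟨hmemx q hq', mem_ball_iff_norm.2 hxη⟩ ⟨hmemy q hq', mem_ball_iff_norm.2 hyη⟩
      have h2 : F q (U s q y) - F q (U s q x) - A (y - x) =
          (F q (U s q y) - F q (U s q x) - A (U s q y - U s q x)) +
            A (U s q y - U s q x - (y - x)) := by
        rw [map_sub A (U s q y - U s q x)]; abel
      rw [h2]
      refine (norm_add_le _ _).trans ?_
      have h3 : ‖A (U s q y - U s q x - (y - x))‖ ≤ K * (2 * K * h * ‖y - x‖) :=
        (A.le_opNorm _).trans (mul_le_mul hA (hv q hq') (norm_nonneg _) hK0)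
      have h4 : ε / 4 * ‖U s q y - U s q x‖ ≤ ε / 4 * (2 * ‖y - x‖) :=
        mul_le_mul_of_nonneg_left (hab q hq') (by positivity)
      nlinarith)
    (s + h) ⟨by linarith, le_rfl⟩
  simp only [hU.init s hs, sub_self, zero_smul, sub_zero, add_sub_cancel_left] at hw
  have heq : U s (s + h) y - y - h • A y - (U s (s + h) x - x - h • A x) =
      U s (s + h) y - U s (s + h) x - h • A (y - x) - (y - x) := by
    rw [map_sub, smul_sub]; abel
  rw [heq]
  linarith

end IsFlow

end Flow

/-! ### Liouville's theorem for divergence-free fields -/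

section Flow

variable {E : Type*} [NormedAddCommGroup E] [NormedSpace ℝ E] [FiniteDimensional ℝ E]
  [MeasurableSpace E] [BorelSpace E] (μ : Measure E) [μ.IsAddHaarMeasure]

/-- If the derivative of an injective locally Lipschitz map has determinant `±1` up to `c`,
the map distorts volumes by a factor `1` up to `c`. -/
lemma LocallyLipschitz.abs_measureReal_image_sub_le {f : E → E} (hf : LocallyLipschitz f)
    (hinj : Function.Injective f) {S : Set E} (hS : MeasurableSet S) (hSfin : μ S ≠ ∞) {c : ℝ}
    (hdet : ∀ x ∈ S, DifferentiableAt ℝ f x → |(|(fderiv ℝ f x).det| - 1)| ≤ c) (hc : 0 ≤ c) :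
    |μ.real (f '' S) - μ.real S| ≤ c * μ.real S := by
  set D := {x | DifferentiableAt ℝ f x}
  have hD : MeasurableSet D := measurableSet_of_differentiableAt ℝ f
  have hDnull : μ (S \ D) = 0 :=
    measure_mono_null (fun x hx => hx.2) (ae_iff.1 (hf.ae_differentiableAt μ))
  have hSD : μ (S ∩ D) = μ S := by
    rw [← measure_inter_add_sdiff S hD, hDnull, add_zero]
  -- By Rademacher's theorem the points of non-differentiability are null, and their image is null
  -- as well. The area formula on the rest therefore computes the volume of the whole image.
  have himg : μ (f '' S) = μ (f '' (S ∩ D)) := by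
    refine le_antisymm ?_ (measure_mono (Set.image_mono Set.inter_subset_left))
    calc μ (f '' S) = μ (f '' (S ∩ D) ∪ f '' (S \ D)) := by
          rw [← Set.image_union, Set.inter_union_sdiff]
      _ ≤ μ (f '' (S ∩ D)) + μ (f '' (S \ D)) := measure_union_le _ _
      _ = μ (f '' (S ∩ D)) := by rw [hf.addHaar_image_eq_zero μ hDnull, add_zero]
  have hint := lintegral_abs_det_fderiv_eq_addHaar_image μ (hS.inter hD)
    (fun x hx => (hx.2 : DifferentiableAt ℝ f x).hasFDerivAt.hasFDerivWithinAt) hinj.injOn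
  have hup : μ (f '' S) ≤ ENNReal.ofReal (1 + c) * μ S := by
    rw [himg, ← hint, ← hSD, ← setLIntegral_const]
    refine setLIntegral_mono' (hS.inter hD) fun x hx => ENNReal.ofReal_le_ofReal ?_
    linarith [(abs_le.1 (hdet x hx.1 hx.2)).2]
  have hlow : ENNReal.ofReal (1 - c) * μ S ≤ μ (f '' S) := by
    rw [himg, ← hint, ← hSD, ← setLIntegral_const]
    refine setLIntegral_mono' (hS.inter hD) fun x hx => ENNReal.ofReal_le_ofReal ?_
    linarith [(abs_le.1 (hdet x hx.1 hx.2)).1]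
  have hne : μ (f '' S) ≠ ∞ := ne_top_of_le_ne_top (ENNReal.mul_ne_top ENNReal.ofReal_ne_top hSfin) hup
  have h1 := ENNReal.toReal_mono (ENNReal.mul_ne_top ENNReal.ofReal_ne_top hSfin) hup
  have h2 := ENNReal.toReal_mono hne hlow
  rw [ENNReal.toReal_mul, ENNReal.toReal_ofReal (by linarith)] at h1
  rw [ENNReal.toReal_mul] at h2
  have h3 : (1 - c) ≤ (ENNReal.ofReal (1 - c)).toReal := by
    rw [ENNReal.toReal_ofReal']; exact le_max_left _ _
  have h4 : 0 ≤ (μ S).toReal := ENNReal.toReal_nonneg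
  simp only [measureReal_def]
  rw [abs_le]
  constructor <;> nlinarith

namespace IsFlow

variable {F : ℝ → E → E} {U : ℝ → ℝ → E → E}

omit [MeasurableSpace E] [BorelSpace E] in
lemma injective (hU : IsFlow F U) (hF : ContDiff ℝ 1 (fun p : ℝ × E => F p.1 p.2))
    {s t : ℝ} (hs : 0 ≤ s) (ht : 0 ≤ t) : Function.Injective (U s t) :=
  (hU.leftInverse hF hs ht).injective

lemma measurableEmbedding (hU : IsFlow F U) (hF : ContDiff ℝ 1 (fun p : ℝ × E => F p.1 p.2))
    {s t : ℝ} (hs : 0 ≤ s) (hst : s ≤ t) : MeasurableEmbedding (U s t) := by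
  have : CompleteSpace E := FiniteDimensional.complete ℝ E
  exact (hU.locallyLipschitz hF hs hst).continuous.measurableEmbedding
    (hU.injective hF hs (hs.trans hst))

/-- The volume of the image, as a function of time, has derivative zero. Over a time h the
determinant of the derivative of the evolution is ±1 up to o(h), because the linear term has trace
zero. Boundedness of the set makes the estimate uniform and the volumes finite. -/
lemma measure_image_of_isBounded (hU : IsFlow F U)
    (hF : ContDiff ℝ 1 (fun p : ℝ × E => F p.1 p.2))
    (hdiv : ∀ t x, LinearMap.trace ℝ E (fderiv ℝ (F t) x : E →ₗ[ℝ] E) = 0)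
    {T : ℝ} (hT : 0 ≤ T) {S : Set E} (hS : MeasurableSet S) (hSb : Bornology.IsBounded S) :
    μ (U 0 T '' S) = μ S := by
  have : ProperSpace E := FiniteDimensional.proper ℝ E
  obtain ⟨R, hR'⟩ := hU.exists_bound_of_isCompact hF hSb.isCompact_closure T
  have hR : ∀ x ∈ S, ∀ r ∈ Set.Icc 0 T, ‖U 0 r x‖ ≤ R := fun x hx => hR' x (subset_closure hx)
  set J : ℝ → ℝ := fun r => μ.real (U 0 r '' S)
  set M := μ.real (Metric.closedBall (0 : E) R)
  have hMfin : μ (Metric.closedBall (0 : E) R) ≠ ∞ := measure_closedBall_lt_top.ne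
  have hsub : ∀ r ∈ Set.Icc 0 T, U 0 r '' S ⊆ Metric.closedBall (0 : E) R := by
    rintro r hr _ ⟨x, hx, rfl⟩
    exact mem_closedBall_zero_iff.2 (hR x hx r hr)
  have hfin : ∀ r ∈ Set.Icc 0 T, μ (U 0 r '' S) ≠ ∞ := fun r hr =>
    ne_top_of_le_ne_top hMfin (measure_mono (hsub r hr))
  have hJM : ∀ r ∈ Set.Icc 0 T, J r ≤ M := fun r hr => measureReal_mono (hsub r hr) hMfin
  have hM0 : 0 ≤ M := measureReal_nonneg
  obtain ⟨K, hK⟩ := exists_norm_fderiv_slice_le hF T R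
  -- the volume changes by at most `o(h)` in time `h`
  have key : ∀ ε > 0, ∃ h₀ > 0, ∀ s h, 0 ≤ s → 0 < h → h ≤ h₀ → s + h ≤ T →
      |J (s + h) - J s| ≤ ε * M * h := by
    intro ε hε
    obtain ⟨h₁, hh₁, η, hη, hdet⟩ := exists_abs_abs_det_sub_one_le (E := E) K hε
    obtain ⟨h₂, hh₂, hder⟩ := hU.exists_norm_fderiv_sub_le hF T R hη
    refine ⟨min h₁ h₂, lt_min hh₁ hh₂, fun s h hs h0 hh hsT => ?_⟩
    have hsI : s ∈ Set.Icc 0 T := ⟨hs, by linarith⟩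
    have himg : U 0 (s + h) '' S = U s (s + h) '' (U 0 s '' S) := by
      rw [Set.image_image]
      refine Set.image_congr fun x _ => ?_
      rw [hU.comp_apply hF le_rfl hs (by linarith)]
    have := (hU.locallyLipschitz hF hs (show s ≤ s + h by linarith)).abs_measureReal_image_sub_le μ
      (hU.injective hF hs (by linarith)) ((hU.measurableEmbedding hF le_rfl hs).measurableSet_image'
        hS) (hfin s hsI) (c := ε * h) ?_ (by positivity)
    · rw [← himg] at this
      refine this.trans ?_
      have h5 : ε * h * J s ≤ ε * h * M :=
        mul_le_mul_of_nonneg_left (hJM s hsI) (by positivity)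
      refine le_trans h5 (le_of_eq (by ring))
    · rintro _ ⟨x, hx, rfl⟩ hdiff
      refine hdet _ _ h (hK s hsI _ (hsub s hsI ⟨x, hx, rfl⟩)) (hdiv s (U 0 s x)) h0
        (hh.trans (min_le_left _ _)) ?_
      refine hder s h _ hs h0 (hh.trans (min_le_right _ _)) hsT (fun r hr => ?_) hdiff
      rw [hU.comp_apply hF le_rfl hs (hs.trans hr.1)]
      exact hR x hx r ⟨hs.trans hr.1, hr.2.trans hsT⟩
  have hderiv : ∀ r ∈ Set.Icc 0 T, HasDerivWithinAt J 0 (Set.Icc 0 T) r := by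
    intro r hr
    rw [hasDerivWithinAt_iff_isLittleO, Asymptotics.isLittleO_iff]
    intro c hc
    obtain ⟨h₀, hh₀, hkey⟩ := key (c / (M + 1)) (by positivity)
    have hcM : c / (M + 1) * M ≤ c := by
      rw [div_mul_eq_mul_div, div_le_iff₀ (by positivity)]; nlinarith
    have hball : Metric.ball r h₀ ∈ 𝓝 r := Metric.ball_mem_nhds r hh₀
    filter_upwards [mem_nhdsWithin_of_mem_nhds hball, self_mem_nhdsWithin] with q hq hqI
    rw [Metric.mem_ball, Real.dist_eq] at hq
    simp only [smul_zero, sub_zero, Real.norm_eq_abs]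
    rcases lt_trichotomy q r with h | h | h
    · rw [abs_of_neg (show q - r < 0 by linarith)] at hq ⊢
      have := hkey q (r - q) hqI.1 (by linarith) (by linarith) (by linarith [hr.2])
      rw [add_sub_cancel, abs_sub_comm] at this
      nlinarith
    · simp [h]
    · rw [abs_of_pos (show 0 < q - r by linarith)] at hq ⊢
      have := hkey r (q - r) hr.1 (by linarith) (by linarith) (by linarith [hqI.2])
      rw [add_sub_cancel] at this
      nlinarith
  have hconst := norm_image_sub_le_of_norm_deriv_le_segment' hderiv
    (fun _ _ => (norm_zero (E := ℝ)).le) T (Set.right_mem_Icc.2 hT)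
  rw [zero_mul, norm_le_zero_iff, sub_eq_zero] at hconst
  have h0 : U 0 0 '' S = S := by
    have : U 0 0 = id := funext fun z => hU.init 0 le_rfl z
    rw [this, Set.image_id]
  have hSfin : μ S ≠ ∞ := h0 ▸ hfin 0 (Set.left_mem_Icc.2 hT)
  simp only [J, h0] at hconst
  exact (measureReal_eq_measureReal_iff (hfin T (Set.right_mem_Icc.2 hT)) hSfin).1 hconst

lemma measurePreserving_zero (hU : IsFlow F U)
    (hF : ContDiff ℝ 1 (fun p : ℝ × E => F p.1 p.2))
    (hdiv : ∀ t x, LinearMap.trace ℝ E (fderiv ℝ (F t) x : E →ₗ[ℝ] E) = 0)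
    {t : ℝ} (ht : 0 ≤ t) : MeasurePreserving (U 0 t) μ μ := by
  have hemb := hU.measurableEmbedding hF le_rfl ht
  have hcomap : μ.comap (U 0 t) = μ := by
    -- Balls of integer radius exhaust the space, so invariance on bounded sets suffices.
    refine (Measure.ext_iff_of_iUnion_eq_univ (Metric.iUnion_ball_nat (0 : E))).2 fun n => ?_
    ext S hS
    rw [Measure.restrict_apply hS, Measure.restrict_apply hS, hemb.comap_apply]
    exact hU.measure_image_of_isBounded μ hF hdiv ht (hS.inter measurableSet_ball)
      (Metric.isBounded_ball.subset Set.inter_subset_right)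
  refine ⟨hemb.measurable, ?_⟩
  ext S hS
  rw [hemb.map_apply, ← hcomap, hemb.comap_apply, hcomap, Set.image_preimage_eq]
  exact (hU.leftInverse hF ht le_rfl).surjective

/-- **Liouville's theorem**: the evolution of a divergence-free vector field preserves volumes. -/
theorem measurePreserving (hU : IsFlow F U)
    (hF : ContDiff ℝ 1 (fun p : ℝ × E => F p.1 p.2))
    (hdiv : ∀ t x, LinearMap.trace ℝ E (fderiv ℝ (F t) x : E →ₗ[ℝ] E) = 0)
    {s t : ℝ} (hs : 0 ≤ s) (ht : 0 ≤ t) : MeasurePreserving (U s t) μ μ := by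
  -- Evolution back to time 0 is the inverse of a volume-preserving map. The general case factors
  -- through time 0, which covers both orders of `s` and `t`.
  have hinv : ∀ {s : ℝ}, 0 ≤ s → MeasurePreserving (U s 0) μ μ := fun {s} hs => by
    have h0 := hU.measurePreserving_zero μ hF hdiv hs
    have hemb := hU.measurableEmbedding hF le_rfl hs
    have hpre : ∀ S, U s 0 ⁻¹' S = U 0 s '' S := fun S =>
      (Set.image_eq_preimage_of_inverse (hU.leftInverse hF le_rfl hs)
        (hU.leftInverse hF hs le_rfl)).symm ▸ rfl
    have hm : Measurable (U s 0) := fun S hS => by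
      rw [hpre]; exact hemb.measurableSet_image' hS
    refine ⟨hm, ?_⟩
    ext S hS
    rw [Measure.map_apply hm hS, hpre, ← h0.measure_preimage_emb hemb,
      Set.preimage_image_eq _ hemb.injective]
  have hcomp : U s t = U 0 t ∘ U s 0 := funext fun z =>
    (hU.comp_apply hF hs le_rfl ht z).symm
  rw [hcomp]
  exact (hU.measurePreserving_zero μ hF hdiv ht).comp (hinv hs)

end IsFlow

end Flow

/-! ### Traces in phase space and partial gradients -/

section Trace

/-- Split `L` into its two output components and use cyclicity of the trace on each; only the
diagonal blocks remain. -/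
lemma LinearMap.trace_prod_eq {V W : Type*} [AddCommGroup V] [Module ℝ V] [AddCommGroup W]
    [Module ℝ W] [Module.Finite ℝ V] [Module.Finite ℝ W] (L : V × W →ₗ[ℝ] V × W) :
    LinearMap.trace ℝ (V × W) L =
      LinearMap.trace ℝ V (LinearMap.fst ℝ V W ∘ₗ L ∘ₗ LinearMap.inl ℝ V W) +
        LinearMap.trace ℝ W (LinearMap.snd ℝ V W ∘ₗ L ∘ₗ LinearMap.inr ℝ V W) := by
  have h : L = LinearMap.inl ℝ V W ∘ₗ (LinearMap.fst ℝ V W ∘ₗ L) +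
      LinearMap.inr ℝ V W ∘ₗ (LinearMap.snd ℝ V W ∘ₗ L) := by
    refine LinearMap.ext fun x => ?_
    simp
  conv_lhs => rw [h, map_add, LinearMap.trace_comp_comm', LinearMap.trace_comp_comm' _ (LinearMap.inr ℝ V W)]
  rfl

lemma trace_config_eq {n : ℕ} (L : Config n →ₗ[ℝ] Config n) :
    LinearMap.trace ℝ (Config n) L = ∑ i, inner ℝ (L (EuclideanSpace.single i 1))
      (EuclideanSpace.single i (1 : ℝ)) := by
  rw [LinearMap.trace_eq_sum_inner L (EuclideanSpace.basisFun (Fin n) ℝ)]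
  refine Finset.sum_congr rfl fun i _ => ?_
  rw [real_inner_comm]
  simp

end Trace

/-- This turns the partial gradients in Hamilton's equations into values of the one derivative of
`Htot` on included vectors, so that smoothness, divergence and power can all be computed from that
derivative. -/
lemma inner_gradient_comp {V E : Type*} [NormedAddCommGroup V] [InnerProductSpace ℝ V]
    [CompleteSpace V] [NormedAddCommGroup E] [NormedSpace ℝ E] {g : E → ℝ} {e : V → E}
    {i : V →L[ℝ] E} {p : V} (he : HasFDerivAt e i p) (hg : DifferentiableAt ℝ g (e p)) (v : V) :
    inner ℝ (∇ (fun p => g (e p)) p) v = fderiv ℝ g (e p) (i v) := by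
  have h : HasFDerivAt (fun p => g (e p)) ((fderiv ℝ g (e p)).comp i) p :=
    hg.hasFDerivAt.comp p he
  rw [gradient, InnerProductSpace.toDual_symm_apply, h.fderiv]
  rfl

/-! ### Hamilton's vector field: regularity, vanishing divergence, power -/

namespace DrivenSystemWithBath

section Inclusions

variable (n m : ℕ)

/-- Inclusion of the coordinates of the system into the tangent space of the whole. -/
noncomputable def sysCoord : Config n →L[ℝ] PhaseSpace n × PhaseSpace m :=
  (ContinuousLinearMap.inl ℝ _ _).comp (ContinuousLinearMap.inl ℝ _ _)

/-- Inclusion of the momenta of the system into the tangent space of the whole. -/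
noncomputable def sysMom : Config n →L[ℝ] PhaseSpace n × PhaseSpace m :=
  (ContinuousLinearMap.inl ℝ _ _).comp (ContinuousLinearMap.inr ℝ _ _)

/-- Inclusion of the coordinates of the bath into the tangent space of the whole. -/
noncomputable def bathCoord : Config m →L[ℝ] PhaseSpace n × PhaseSpace m :=
  (ContinuousLinearMap.inr ℝ _ _).comp (ContinuousLinearMap.inl ℝ _ _)

/-- Inclusion of the momenta of the bath into the tangent space of the whole. -/
noncomputable def bathMom : Config m →L[ℝ] PhaseSpace n × PhaseSpace m :=
  (ContinuousLinearMap.inr ℝ _ _).comp (ContinuousLinearMap.inr ℝ _ _)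

end Inclusions

variable {n m : ℕ} {ι : Type*} {S : DrivenSystemWithBath n m ι}

namespace Regular

lemma contDiff_Htot (hS : S.Regular) : ContDiff ℝ 2 S.Htot :=
  ((hS.contDiff_H.comp contDiff_fst).add (hS.contDiff_Hb.comp contDiff_snd)).add hS.contDiff_Hint

lemma differentiable_Htot (hS : S.Regular) : Differentiable ℝ S.Htot :=
  hS.contDiff_Htot.differentiable two_ne_zero

variable (hS : S.Regular) (t : ℝ) (z : PhaseSpace n × PhaseSpace m)
include hS

lemma inner_hamiltonField_sysCoord (v : Config n) :
    inner ℝ (S.hamiltonField t z).1.1 v = fderiv ℝ S.Htot z (sysMom n m v) := by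
  have he : HasFDerivAt (fun p => (((z.1.1, p), z.2) : PhaseSpace n × PhaseSpace m))
      (sysMom n m) z.1.2 :=
    (hasFDerivAt_prodMk_left (𝕜 := ℝ) (z.1.1, z.1.2) z.2).comp z.1.2
      (hasFDerivAt_prodMk_right (𝕜 := ℝ) z.1.1 z.1.2)
  exact inner_gradient_comp he (hS.differentiable_Htot _) v

lemma inner_hamiltonField_sysMom (v : Config n) :
    inner ℝ (S.hamiltonField t z).1.2 v =
      -fderiv ℝ S.Htot z (sysCoord n m v) + inner ℝ (S.force z.1.1 t) v := by
  have he : HasFDerivAt (fun q => (((q, z.1.2), z.2) : PhaseSpace n × PhaseSpace m))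
      (sysCoord n m) z.1.1 :=
    (hasFDerivAt_prodMk_left (𝕜 := ℝ) (z.1.1, z.1.2) z.2).comp z.1.1
      (hasFDerivAt_prodMk_left (𝕜 := ℝ) z.1.1 z.1.2)
  simp only [hamiltonField]
  rw [inner_add_left, inner_neg_left, inner_gradient_comp he (hS.differentiable_Htot _) v]

lemma inner_hamiltonField_bathCoord (v : Config m) :
    inner ℝ (S.hamiltonField t z).2.1 v = fderiv ℝ S.Htot z (bathMom n m v) := by
  have he : HasFDerivAt (fun P => ((z.1, (z.2.1, P)) : PhaseSpace n × PhaseSpace m))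
      (bathMom n m) z.2.2 :=
    (hasFDerivAt_prodMk_right (𝕜 := ℝ) z.1 (z.2.1, z.2.2)).comp z.2.2
      (hasFDerivAt_prodMk_right (𝕜 := ℝ) z.2.1 z.2.2)
  exact inner_gradient_comp he (hS.differentiable_Htot _) v

lemma inner_hamiltonField_bathMom (v : Config m) :
    inner ℝ (S.hamiltonField t z).2.2 v = -fderiv ℝ S.Htot z (bathCoord n m v) := by
  have he : HasFDerivAt (fun Q => ((z.1, (Q, z.2.2)) : PhaseSpace n × PhaseSpace m))
      (bathCoord n m) z.2.1 :=
    (hasFDerivAt_prodMk_right (𝕜 := ℝ) z.1 (z.2.1, z.2.2)).comp z.2.1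
      (hasFDerivAt_prodMk_left (𝕜 := ℝ) z.2.1 z.2.2)
  simp only [hamiltonField]
  rw [inner_neg_left, inner_gradient_comp he (hS.differentiable_Htot _) v]

omit t z

lemma contDiff_hamiltonField :
    ContDiff ℝ 1 (fun p : ℝ × (PhaseSpace n × PhaseSpace m) => S.hamiltonField p.1 p.2) := by
  have hD : ContDiff ℝ 1 (fun p : ℝ × (PhaseSpace n × PhaseSpace m) => fderiv ℝ S.Htot p.2) :=
    (hS.contDiff_Htot.fderiv_right (m := 1) (by norm_num)).comp contDiff_snd
  have hf : ContDiff ℝ 1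
      (fun p : ℝ × (PhaseSpace n × PhaseSpace m) => S.force p.2.1.1 p.1) :=
    hS.contDiff_force.comp (g := fun x : Config n × ℝ => S.force x.1 x.2)
      (f := fun p : ℝ × (PhaseSpace n × PhaseSpace m) => (p.2.1.1, p.1)) (by fun_prop)
  have hcoord : ∀ {k : ℕ} (y : Config k) (i : Fin k),
      y i = inner ℝ y (EuclideanSpace.single i (1 : ℝ)) := fun y i => by
    simp [EuclideanSpace.inner_single_right]
  refine ContDiff.prodMk (ContDiff.prodMk ?_ ?_) (ContDiff.prodMk ?_ ?_)
  all_goals rw [contDiff_euclidean]; intro i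
  · have : (fun p : ℝ × (PhaseSpace n × PhaseSpace m) => (S.hamiltonField p.1 p.2).1.1 i) =
      fun p => fderiv ℝ S.Htot p.2 (sysMom n m (EuclideanSpace.single i 1)) := by
      funext p; rw [hcoord, hS.inner_hamiltonField_sysCoord]
    exact this ▸ hD.clm_apply contDiff_const
  · have : (fun p : ℝ × (PhaseSpace n × PhaseSpace m) => (S.hamiltonField p.1 p.2).1.2 i) =
      fun p => -fderiv ℝ S.Htot p.2 (sysCoord n m (EuclideanSpace.single i 1)) +
        inner ℝ (S.force p.2.1.1 p.1) (EuclideanSpace.single i (1 : ℝ)) := by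
      funext p; rw [hcoord, hS.inner_hamiltonField_sysMom]
    exact this ▸ (hD.clm_apply contDiff_const).neg.add (hf.inner ℝ contDiff_const)
  · have : (fun p : ℝ × (PhaseSpace n × PhaseSpace m) => (S.hamiltonField p.1 p.2).2.1 i) =
      fun p => fderiv ℝ S.Htot p.2 (bathMom n m (EuclideanSpace.single i 1)) := by
      funext p; rw [hcoord, hS.inner_hamiltonField_bathCoord]
    exact this ▸ hD.clm_apply contDiff_const
  · have : (fun p : ℝ × (PhaseSpace n × PhaseSpace m) => (S.hamiltonField p.1 p.2).2.2 i) =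
      fun p => -fderiv ℝ S.Htot p.2 (bathCoord n m (EuclideanSpace.single i 1)) := by
      funext p; rw [hcoord, hS.inner_hamiltonField_bathMom]
    exact this ▸ (hD.clm_apply contDiff_const).neg

/-- Hamilton's vector field, with a force that does not depend on the momenta, is
divergence-free. -/
lemma trace_fderiv_hamiltonField (t : ℝ) (z : PhaseSpace n × PhaseSpace m) :
    LinearMap.trace ℝ _ (fderiv ℝ (S.hamiltonField t) z :
      PhaseSpace n × PhaseSpace m →ₗ[ℝ] PhaseSpace n × PhaseSpace m) = 0 := by
  set L := fderiv ℝ (S.hamiltonField t) z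
  have hL : HasFDerivAt (S.hamiltonField t) L z :=
    (differentiable_slice hS.contDiff_hamiltonField t z).hasFDerivAt
  set D2 := fderiv ℝ (fderiv ℝ S.Htot) z
  have hD2 : HasFDerivAt (fderiv ℝ S.Htot) D2 z :=
    ((hS.contDiff_Htot.fderiv_right (m := 1) (by norm_num)).differentiable one_ne_zero
      z).hasFDerivAt
  have hsymm : ∀ v w, D2 v w = D2 w v :=
    (hS.contDiff_Htot.contDiffAt (x := z)).isSymmSndFDerivAt (by simp)
  have hD2v : ∀ v, HasFDerivAt (fun z => fderiv ℝ S.Htot z v)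
      ((ContinuousLinearMap.apply ℝ ℝ v).comp D2) z := fun v =>
    (ContinuousLinearMap.apply ℝ ℝ v).hasFDerivAt.comp z hD2
  have hq : ∀ w v, inner ℝ (L w).1.1 v = D2 w (sysMom n m v) := fun w v => by
    have h1 : HasFDerivAt (fun z => inner ℝ (S.hamiltonField t z).1.1 v)
        ((innerSL ℝ v).comp ((ContinuousLinearMap.fst ℝ _ _).comp
          ((ContinuousLinearMap.fst ℝ _ _).comp L))) z := by
      simp only [real_inner_comm v]
      exact (innerSL ℝ v).hasFDerivAt.comp z hL.fst.fst
    simp only [hS.inner_hamiltonField_sysCoord] at h1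
    have := congrArg (fun A => A w) (h1.unique (hD2v _))
    simpa [real_inner_comm v] using this
  have hQ : ∀ w v, inner ℝ (L w).2.1 v = D2 w (bathMom n m v) := fun w v => by
    have h1 : HasFDerivAt (fun z => inner ℝ (S.hamiltonField t z).2.1 v)
        ((innerSL ℝ v).comp ((ContinuousLinearMap.fst ℝ _ _).comp
          ((ContinuousLinearMap.snd ℝ _ _).comp L))) z := by
      simp only [real_inner_comm v]
      exact (innerSL ℝ v).hasFDerivAt.comp z hL.snd.fst
    simp only [hS.inner_hamiltonField_bathCoord] at h1
    have := congrArg (fun A => A w) (h1.unique (hD2v _))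
    simpa [real_inner_comm v] using this
  have hP : ∀ w v, inner ℝ (L w).2.2 v = -D2 w (bathCoord n m v) := fun w v => by
    have h1 : HasFDerivAt (fun z => inner ℝ (S.hamiltonField t z).2.2 v)
        ((innerSL ℝ v).comp ((ContinuousLinearMap.snd ℝ _ _).comp
          ((ContinuousLinearMap.snd ℝ _ _).comp L))) z := by
      simp only [real_inner_comm v]
      exact (innerSL ℝ v).hasFDerivAt.comp z hL.snd.snd
    simp only [hS.inner_hamiltonField_bathMom] at h1
    have := congrArg (fun A => A w) (h1.unique (hD2v _).neg)
    simpa [real_inner_comm v] using this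
  have hp : ∀ u v, inner ℝ (L (sysMom n m u)).1.2 v =
      -D2 (sysMom n m u) (sysCoord n m v) := fun u v => by
    have h1 : HasFDerivAt (fun z => inner ℝ (S.hamiltonField t z).1.2 v)
        ((innerSL ℝ v).comp ((ContinuousLinearMap.snd ℝ _ _).comp
          ((ContinuousLinearMap.fst ℝ _ _).comp L))) z := by
      simp only [real_inner_comm v]
      exact (innerSL ℝ v).hasFDerivAt.comp z hL.fst.snd
    -- along the momenta the force does not change
    have hl : HasDerivAt (fun r : ℝ => z + r • sysMom n m u) (sysMom n m u) 0 := by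
      simpa using ((hasDerivAt_id (0 : ℝ)).smul_const (sysMom n m u)).const_add z
    have hz0 : z + (0 : ℝ) • sysMom n m u = z := by simp
    have h2 := (hz0.symm ▸ h1 : HasFDerivAt _ _ (z + (0 : ℝ) • sysMom n m u)).comp_hasDerivAt
      (0 : ℝ) hl
    have h3 := (hz0.symm ▸ (hD2v (sysCoord n m v)).neg :
      HasFDerivAt _ _ (z + (0 : ℝ) • sysMom n m u)).comp_hasDerivAt (0 : ℝ) hl
    have h4 := h3.add_const (inner ℝ (S.force z.1.1 t) v)
    have h5 : (fun z => inner ℝ (S.hamiltonField t z).1.2 v) ∘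
        (fun r : ℝ => z + r • sysMom n m u) = fun r =>
        ((fun z => -fderiv ℝ S.Htot z (sysCoord n m v)) ∘
          (fun r : ℝ => z + r • sysMom n m u)) r + inner ℝ (S.force z.1.1 t) v := by
      funext r
      simp only [Function.comp_apply, hS.inner_hamiltonField_sysMom]
      congr 3
      simp [sysMom]
    rw [h5] at h2
    have := h2.unique h4
    simpa [real_inner_comm v] using this
  rw [LinearMap.trace_prod_eq, LinearMap.trace_prod_eq, LinearMap.trace_prod_eq,
    trace_config_eq, trace_config_eq, trace_config_eq, trace_config_eq]
  -- Each conjugate pair contributes a mixed second derivative of `Htot` and its negative; they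
  -- cancel by symmetry.
  have e1 : ∀ i : Fin n, inner ℝ (L (sysCoord n m (EuclideanSpace.single i 1))).1.1
      (EuclideanSpace.single i (1 : ℝ)) + inner ℝ (L (sysMom n m (EuclideanSpace.single i 1))).1.2
      (EuclideanSpace.single i (1 : ℝ)) = 0 := fun i => by
    rw [hq, hp, hsymm]; ring
  have e2 : ∀ i : Fin m, inner ℝ (L (bathCoord n m (EuclideanSpace.single i 1))).2.1
      (EuclideanSpace.single i (1 : ℝ)) + inner ℝ (L (bathMom n m (EuclideanSpace.single i 1))).2.2
      (EuclideanSpace.single i (1 : ℝ)) = 0 := fun i => by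
    rw [hQ, hP, hsymm]; ring
  rw [← Finset.sum_add_distrib, ← Finset.sum_add_distrib]
  exact (congrArg₂ (· + ·) (Finset.sum_eq_zero fun i _ => e1 i)
    (Finset.sum_eq_zero fun i _ => e2 i)).trans (add_zero 0)

/-- The power of the external force is the rate of change of the energy. -/
lemma fderiv_Htot_hamiltonField (t : ℝ) (z : PhaseSpace n × PhaseSpace m) :
    fderiv ℝ S.Htot z (S.hamiltonField t z) =
      inner ℝ (S.force z.1.1 t) (S.hamiltonField t z).1.1 := by
  set X := S.hamiltonField t z
  have hX : X = sysCoord n m X.1.1 + sysMom n m X.1.2 + (bathCoord n m X.2.1 +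
      bathMom n m X.2.2) := by
    simp [sysCoord, sysMom, bathCoord, bathMom]
  -- Pair the velocity of each variable with that of its conjugate. In the sum the conservative
  -- terms cancel, since the inner product is symmetric, and only the force remains.
  have h1 := hS.inner_hamiltonField_sysCoord t z X.1.2
  have h2 := hS.inner_hamiltonField_sysMom t z X.1.1
  have h3 := hS.inner_hamiltonField_bathCoord t z X.2.2
  have h4 := hS.inner_hamiltonField_bathMom t z X.2.1
  have h5 : inner ℝ X.1.2 X.1.1 = inner ℝ X.1.1 X.1.2 := real_inner_comm _ _
  have h6 : inner ℝ X.2.2 X.2.1 = inner ℝ X.2.1 X.2.2 := real_inner_comm _ _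
  conv_lhs => rw [hX]
  rw [map_add, map_add, map_add]
  linarith

end Regular

variable {U : ℝ → ℝ → PhaseSpace n × PhaseSpace m → PhaseSpace n × PhaseSpace m}

lemma IsEvolution.isFlow (hU : S.IsEvolution U) : IsFlow S.hamiltonField U :=
  ⟨fun s hs z => (hU s hs z).1, fun s hs z t ht => (hU s hs z).2 t ht⟩

lemma jointMeasure_eq (hS : S.Regular) :
    S.jointMeasure = (liouville S.h n).prod (liouville S.h m) := by
  have hh : 0 < S.h := hS.h_pos
  rw [liouville, liouville, Measure.prod_smul_left, Measure.prod_smul_right, smul_smul,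
    ← ENNReal.ofReal_mul (by positivity), ← mul_inv, ← pow_add]
  rfl

lemma IsEvolution.measurePreserving (hU : S.IsEvolution U) (hS : S.Regular) {s t : ℝ}
    (hs : 0 ≤ s) (ht : 0 ≤ t) : MeasurePreserving (U s t) S.jointMeasure S.jointMeasure := by
  have : MeasurePreserving (U s t) (volume : Measure (PhaseSpace n × PhaseSpace m)) volume := by
    have : (volume : Measure (PhaseSpace n × PhaseSpace m)).IsAddHaarMeasure :=
by
      have h1 : ∀ k, (volume : Measure (Config k)).IsAddHaarMeasure := fun k => inferInstance
      have h2 : ∀ k, ((volume : Measure (Config k)).prod (volume : Measure (Config k))).IsAddHaarMeasure := fun k => Measure.prod.instIsAddHaarMeasure _ _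
      exact Measure.prod.instIsAddHaarMeasure _ _
    exact hU.isFlow.measurePreserving volume hS.contDiff_hamiltonField
      hS.trace_fderiv_hamiltonField hs ht
  exact this.smul_measure _

end DrivenSystemWithBath

/-! ### Work as change of energy -/

namespace DrivenSystemWithBath

variable {n m : ℕ} {ι : Type*} {S : DrivenSystemWithBath n m ι}
variable {U : ℝ → ℝ → PhaseSpace n × PhaseSpace m → PhaseSpace n × PhaseSpace m}

/-- The work of the external force is the change of the total energy. -/
lemma IsEvolution.work_eq (hU : S.IsEvolution U) (hS : S.Regular) {t : ℝ} (ht : 0 ≤ t)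
    (z : PhaseSpace n × PhaseSpace m) : S.work U t z = S.Htot (U 0 t z) - S.Htot z := by
  have hfl := hU.isFlow
  have hcont : ContinuousOn (fun s => U 0 s z) (Set.Icc 0 t) :=
    (hfl.continuousOn le_rfl z).mono fun _ h => h.1
  have hcont' : ContinuousOn (fun s => ((s, U 0 s z) : ℝ × (PhaseSpace n × PhaseSpace m)))
      (Set.Icc 0 t) := continuousOn_id.prodMk hcont
  have hc : Continuous (fun p : ℝ × (PhaseSpace n × PhaseSpace m) =>
      (S.hamiltonField p.1 p.2).1.1) := hS.contDiff_hamiltonField.continuous.fst.fst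
  have hX : ContinuousOn (fun s => (S.hamiltonField s (U 0 s z)).1.1) (Set.Icc 0 t) :=
    hc.comp_continuousOn (f := fun s => (s, U 0 s z)) hcont'
  have hf : ContinuousOn (fun s => S.force (U 0 s z).1.1 s) (Set.Icc 0 t) :=
    hS.contDiff_force.continuous.comp_continuousOn (hcont.fst.fst.prodMk continuousOn_id)
  have hderiv : ∀ s ∈ Set.Ioo 0 t, HasDerivWithinAt (fun s => S.Htot (U 0 s z))
      (inner ℝ (S.force (U 0 s z).1.1 s) (S.hamiltonField s (U 0 s z)).1.1) (Set.Ioi s) s :=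
    fun s hs => by
      rw [← hS.fderiv_Htot_hamiltonField]
      have h1 := (hS.differentiable_Htot (U 0 s z)).hasFDerivAt
      have h2 := (hfl.deriv 0 le_rfl z s hs.1.le).mono
        (show Set.Ioi s ⊆ Set.Ici 0 from fun q hq => (hs.1.trans hq).le)
      exact h1.comp_hasDerivWithinAt s h2
  have hH : ContinuousOn (fun s => S.Htot (U 0 s z)) (Set.Icc 0 t) :=
    hS.contDiff_Htot.continuous.comp_continuousOn hcont
  have hint := (hf.inner (𝕜 := ℝ) hX).intervalIntegrable_of_Icc (μ := volume) ht
  have := intervalIntegral.integral_eq_sub_of_hasDeriv_right_of_le ht hH hderiv hint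
  rw [work, this, hfl.init 0 le_rfl]

end DrivenSystemWithBath

/-! ### Coarse-graining over a countable partition -/

section CoarseGraining

variable {Γ Γ' κ : Type*} [MeasurableSpace Γ] [MeasurableSpace Γ'] [Countable κ]
  {μ : Measure Γ} {c : Γ → κ} {c' : Γ' → κ}

lemma measurable_comp_cell {β : Type*} [MeasurableSpace β]
    (hc : ∀ k, MeasurableSet (c ⁻¹' {k})) (g : κ → β) : Measurable (fun x => g (c x)) := by
  -- With the discrete σ-algebra on the countable set of labels, every function of the label is
  -- measurable.
  let _ : MeasurableSpace κ := ⊤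
  have h1 : Measurable c := measurable_to_countable' hc
  exact (measurable_from_top (f := g)).comp h1

/-- Functions of the cell have the same average with respect to measures that give the same
weights to the cells. -/
lemma integrable_comp_cell_iff {P : Measure Γ} {Q : Measure Γ'}
    (hc : ∀ k, MeasurableSet (c ⁻¹' {k})) (hc' : ∀ k, MeasurableSet (c' ⁻¹' {k}))
    (hPQ : ∀ k, P (c ⁻¹' {k}) = Q (c' ⁻¹' {k})) (g : κ → ℝ) :
    (Integrable (fun x => g (c x)) P ↔ Integrable (fun x => g (c' x)) Q) ∧
      ∫ x, g (c x) ∂P = ∫ x, g (c' x) ∂Q := by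
  let _ : MeasurableSpace κ := ⊤
  have h1 : Measurable c := measurable_to_countable' hc
  have h2 : Measurable c' := measurable_to_countable' hc'
  have hg : Measurable g := measurable_from_top
  have hmap : P.map c = Q.map c' := by
    refine Measure.ext_of_singleton fun k => ?_
    rw [Measure.map_apply h1 (measurableSet_singleton k),
      Measure.map_apply h2 (measurableSet_singleton k), hPQ]
  constructor
  · have e1 := integrable_map_measure (μ := P) (g := g) hg.aestronglyMeasurable h1.aemeasurable
    have e2 := integrable_map_measure (μ := Q) (g := g) hg.aestronglyMeasurable h2.aemeasurable
    rw [hmap] at e1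
    exact e1.symm.trans e2
  · rw [← integral_map h1.aemeasurable hg.aestronglyMeasurable, hmap,
      integral_map h2.aemeasurable hg.aestronglyMeasurable]

lemma lintegral_comp_cell {P : Measure Γ} (hc : ∀ k, MeasurableSet (c ⁻¹' {k})) (g : κ → ℝ≥0∞) :
    ∫⁻ x, g (c x) ∂P = ∑' k, g k * P (c ⁻¹' {k}) := by
  let _ : MeasurableSpace κ := ⊤
  have h1 : Measurable c := measurable_to_countable' hc
  have hg : Measurable g := measurable_from_top
  rw [← lintegral_map hg h1, lintegral_countable']
  simp_rw [Measure.map_apply h1 (measurableSet_singleton _)]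

/-- There are only countably many cells, so the union of the null ones is null. This keeps
logarithms of cell probabilities away from zero almost everywhere. -/
lemma ae_measure_cell_ne_zero (P : Measure Γ) : ∀ᵐ x ∂P, P (c ⁻¹' {c x}) ≠ 0 := by
  rw [ae_iff]
  refine measure_mono_null (t := ⋃ k ∈ {k | P (c ⁻¹' {k}) = 0}, c ⁻¹' {k}) (fun x hx => ?_)
    ((measure_biUnion_null_iff (Set.to_countable _)).2 fun k hk => hk)
  simp only [ne_eq, not_not] at hx
  exact Set.mem_biUnion hx rfl

omit [Countable κ] in
lemma coarseGrain_eq_of_mem {ρ : Γ → ℝ} {k : κ} {x : Γ} (hx : x ∈ c ⁻¹' {k}) :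
    coarseGrain μ c ρ x = ⨍ y in c ⁻¹' {k}, ρ y ∂μ := by
  have : c x = k := hx
  rw [coarseGrain, this]

lemma measurable_coarseGrain (hc : ∀ k, MeasurableSet (c ⁻¹' {k})) (ρ : Γ → ℝ) :
    Measurable (coarseGrain μ c ρ) :=
  measurable_comp_cell hc (fun k => ⨍ y in c ⁻¹' {k}, ρ y ∂μ)

omit [Countable κ] in
lemma setAverage_mem_Icc {ρ : Γ → ℝ} {M : ℝ} (hM : 0 ≤ M) (h : ∀ x, ρ x ∈ Set.Icc 0 M) (k : κ)
    (hfin : μ (c ⁻¹' {k}) ≠ ∞) : ⨍ y in c ⁻¹' {k}, ρ y ∂μ ∈ Set.Icc 0 M := by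
  rw [setAverage_eq, smul_eq_mul]
  have hμ : 0 ≤ μ.real (c ⁻¹' {k}) := measureReal_nonneg
  refine ⟨mul_nonneg (inv_nonneg.2 hμ) (integral_nonneg fun x => (h x).1), ?_⟩
  rcases hμ.eq_or_lt with h0 | h0
  · simpa [← h0] using hM
  · rw [inv_mul_le_iff₀ h0, mul_comm]
    by_cases hi : IntegrableOn ρ (c ⁻¹' {k}) μ
    · have := setIntegral_mono (μ := μ) (s := c ⁻¹' {k}) hi
        (integrableOn_const (C := M) hfin) (fun x => (h x).2)
      simpa [mul_comm] using this
    -- A non-integrable function has integral 0 by convention, which also satisfies the bound.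
    · rw [integral_undef hi]; positivity

omit [Countable κ] in
lemma coarseGrain_mem_Icc (hfin : ∀ k, μ (c ⁻¹' {k}) ≠ ∞) {ρ : Γ → ℝ} {M : ℝ} (hM : 0 ≤ M)
    (h : ∀ x, ρ x ∈ Set.Icc 0 M) (x : Γ) : coarseGrain μ c ρ x ∈ Set.Icc 0 M :=
  setAverage_mem_Icc hM h (c x) (hfin (c x))

omit [Countable κ] in
lemma coarseGrain_nonneg {ρ : Γ → ℝ} (h : ∀ x, 0 ≤ ρ x) (x : Γ) : 0 ≤ coarseGrain μ c ρ x := by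
  rw [coarseGrain, setAverage_eq, smul_eq_mul]
  exact mul_nonneg (inv_nonneg.2 measureReal_nonneg) (integral_nonneg h)

omit [Countable κ] in
lemma setIntegral_coarseGrain (hc : ∀ k, MeasurableSet (c ⁻¹' {k}))
    (hfin : ∀ k, μ (c ⁻¹' {k}) ≠ ∞) (ρ : Γ → ℝ) (k : κ) :
    ∫ x in c ⁻¹' {k}, coarseGrain μ c ρ x ∂μ = ∫ x in c ⁻¹' {k}, ρ x ∂μ := by
  rw [setIntegral_congr_fun (g := fun _ => ⨍ y in c ⁻¹' {k}, ρ y ∂μ) (hc k)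
    (fun x hx => coarseGrain_eq_of_mem hx), setIntegral_const]
  exact measure_smul_setAverage _ (hfin k)

omit [MeasurableSpace Γ] [Countable κ] in
lemma iUnion_cell : ⋃ k, c ⁻¹' {k} = Set.univ :=
  Set.eq_univ_of_forall fun x => Set.mem_iUnion.2 ⟨c x, rfl⟩

omit [MeasurableSpace Γ] [Countable κ] in
lemma pairwise_disjoint_cell : Pairwise (Function.onFun Disjoint fun k => c ⁻¹' {k}) :=
  fun _ _ hij => Set.disjoint_left.2 fun _ hx hy => hij (hx.symm.trans hy)

/-- Averaging contracts the L¹ norm on each cell by the triangle inequality for integrals; summing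
over the cells gives finiteness. -/
lemma MeasureTheory.Integrable.coarseGrain (hc : ∀ k, MeasurableSet (c ⁻¹' {k}))
    (hfin : ∀ k, μ (c ⁻¹' {k}) ≠ ∞) {ρ : Γ → ℝ} (hρ : Integrable ρ μ) :
    Integrable (coarseGrain μ c ρ) μ := by
  refine ⟨(measurable_coarseGrain hc ρ).aestronglyMeasurable, ?_⟩
  have hpart : ∀ f : Γ → ℝ≥0∞, ∫⁻ x, f x ∂μ = ∑' k, ∫⁻ x in c ⁻¹' {k}, f x ∂μ := fun f => by
    rw [← lintegral_iUnion hc pairwise_disjoint_cell, iUnion_cell, setLIntegral_univ]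
  refine lt_of_le_of_lt ?_ hρ.hasFiniteIntegral
  rw [hpart, hpart (fun x => ‖ρ x‖ₑ)]
  refine ENNReal.tsum_le_tsum fun k => ?_
  rw [setLIntegral_congr_fun (g := fun _ => ‖⨍ y in c ⁻¹' {k}, ρ y ∂μ‖ₑ) (hc k)
    (fun x hx => by rw [coarseGrain_eq_of_mem hx]), setLIntegral_const]
  have h1 := enorm_integral_le_lintegral_enorm (μ := μ.restrict (c ⁻¹' {k})) ρ
  refine le_trans (le_of_eq ?_) h1
  rw [← measure_smul_setAverage ρ (hfin k), enorm_smul, mul_comm]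
  congr 1
  rw [measureReal_def, Real.enorm_eq_ofReal ENNReal.toReal_nonneg, ENNReal.ofReal_toReal (hfin k)]

lemma integral_coarseGrain (hc : ∀ k, MeasurableSet (c ⁻¹' {k}))
    (hfin : ∀ k, μ (c ⁻¹' {k}) ≠ ∞) {ρ : Γ → ℝ} (hρ : Integrable ρ μ) :
    ∫ x, coarseGrain μ c ρ x ∂μ = ∫ x, ρ x ∂μ := by
  have hpart : ∀ f : Γ → ℝ, Integrable f μ →
      ∫ x, f x ∂μ = ∑' k, ∫ x in c ⁻¹' {k}, f x ∂μ := fun f hf => by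
    rw [← integral_iUnion hc pairwise_disjoint_cell (by rw [iUnion_cell]; exact hf.integrableOn),
      iUnion_cell, setIntegral_univ]
  rw [hpart _ (hρ.coarseGrain hc hfin), hpart _ hρ]
  simp_rw [setIntegral_coarseGrain hc hfin]

/-- Coarse-graining does not decrease the entropy. -/
lemma integral_negMulLog_le_coarseGrain (hc : ∀ k, MeasurableSet (c ⁻¹' {k}))
    (hfin : ∀ k, μ (c ⁻¹' {k}) ≠ ∞) {u : Γ → ℝ} (hu0 : ∀ x, 0 ≤ u x) (hu : Integrable u μ)
    (hS : Integrable (fun x => Real.negMulLog (u x)) μ)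
    (hSc : Integrable (fun x => Real.negMulLog (coarseGrain μ c u x)) μ) :
    ∫ x, Real.negMulLog (u x) ∂μ ≤ ∫ x, Real.negMulLog (coarseGrain μ c u x) ∂μ := by
  -- Averaging `negMulLog` of `u` over the cells keeps its integral, and Jensen's inequality then
  -- compares the two integrands cell by cell. On a null cell both averages are 0 by convention.
  rw [← integral_coarseGrain hc hfin hS]
  refine integral_mono (hS.coarseGrain hc hfin) hSc fun x => ?_
  simp only [coarseGrain]
  by_cases h0 : μ (c ⁻¹' {c x}) = 0
  · simp [setAverage_eq, measureReal_def, h0]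
  · exact Real.concaveOn_negMulLog.le_map_set_average
      Real.continuous_negMulLog.continuousOn isClosed_Ici h0 (hfin _)
      (Eventually.of_forall fun y => hu0 y) hu.integrableOn hS.integrableOn

/-- Cell probabilities do not change under coarse-graining, so the mean of any function of the cell
may be taken with either density. -/
lemma withDensity_coarseGrain_cell (hc : ∀ k, MeasurableSet (c ⁻¹' {k}))
    (hfin : ∀ k, μ (c ⁻¹' {k}) ≠ ∞) {ρ : Γ → ℝ} (hρ0 : ∀ x, 0 ≤ ρ x) (hρ : Integrable ρ μ)
    (k : κ) :
    μ.withDensity (fun x => ENNReal.ofReal (coarseGrain μ c ρ x)) (c ⁻¹' {k}) =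
      ENNReal.ofReal (∫ x in c ⁻¹' {k}, ρ x ∂μ) := by
  rw [withDensity_apply _ (hc k), ← setIntegral_coarseGrain hc hfin,
    ofReal_integral_eq_lintegral_ofReal (hρ.coarseGrain hc hfin).integrableOn
      (Eventually.of_forall (coarseGrain_nonneg hρ0))]

omit [Countable κ] in
-- Null cells with a non-zero value have to be excluded, because the average over a null cell is 0
-- by convention.
lemma coarseGrain_of_const {ρ : Γ → ℝ} {a : κ → ℝ} (hc : ∀ k, MeasurableSet (c ⁻¹' {k}))
    (hρ : ∀ x, ρ x = a (c x)) (h0 : ∀ x, a (c x) ≠ 0 → μ (c ⁻¹' {c x}) ≠ 0)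
    (hfin : ∀ k, μ (c ⁻¹' {k}) ≠ ∞) : coarseGrain μ c ρ = ρ := by
  funext x
  have h1 : ∫ y in c ⁻¹' {c x}, ρ y ∂μ = μ.real (c ⁻¹' {c x}) * a (c x) := by
    rw [setIntegral_congr_fun (g := fun _ => a (c x)) (hc _) (fun y hy => by
      have : c y = c x := hy
      simp only [hρ, this]), setIntegral_const, smul_eq_mul]
  rw [coarseGrain, setAverage_eq, smul_eq_mul, h1, hρ]
  by_cases ha : a (c x) = 0
  · simp [ha]
  · have : μ.real (c ⁻¹' {c x}) ≠ 0 := by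
      rw [measureReal_def, ENNReal.toReal_ne_zero]
      exact ⟨h0 x ha, hfin _⟩
    field_simp

end CoarseGraining

/-! ### Averages and entropies with respect to a density -/

section Density

variable {Γ : Type*} [MeasurableSpace Γ] {μ : Measure Γ} {ρ : Γ → ℝ}

lemma integrable_withDensity_ofReal_iff (hρ : Measurable ρ) (hρ0 : ∀ x, 0 ≤ ρ x) (G : Γ → ℝ) :
    Integrable G (μ.withDensity fun x => ENNReal.ofReal (ρ x)) ↔
      Integrable (fun x => ρ x * G x) μ := by
  rw [integrable_withDensity_iff hρ.ennreal_ofReal (by simp)]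
  simp only [ENNReal.toReal_ofReal (hρ0 _), mul_comm]

lemma integral_withDensity_ofReal (hρ : Measurable ρ) (hρ0 : ∀ x, 0 ≤ ρ x) (G : Γ → ℝ) :
    ∫ x, G x ∂(μ.withDensity fun x => ENNReal.ofReal (ρ x)) = ∫ x, ρ x * G x ∂μ := by
  rw [integral_withDensity_eq_integral_toReal_smul hρ.ennreal_ofReal (by simp)]
  simp only [ENNReal.toReal_ofReal (hρ0 _), smul_eq_mul]

end Density

/-- The entropy of the coarse-grained density as an average over the original one. -/
lemma integrable_negMulLog_coarseGrain_iff {Γ κ : Type*} [MeasurableSpace Γ] [Countable κ]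
    {μ : Measure Γ} {c : Γ → κ} (hc : ∀ k, MeasurableSet (c ⁻¹' {k}))
    (hfin : ∀ k, μ (c ⁻¹' {k}) ≠ ∞) {ρ : Γ → ℝ} (hρ0 : ∀ x, 0 ≤ ρ x) (hρ : Integrable ρ μ) :
    (Integrable (fun x => Real.negMulLog (coarseGrain μ c ρ x)) μ ↔
      Integrable (fun x => -Real.log (coarseGrain μ c ρ x))
        (μ.withDensity fun x => ENNReal.ofReal (ρ x))) ∧
    ∫ x, Real.negMulLog (coarseGrain μ c ρ x) ∂μ =
      ∫ x, -Real.log (coarseGrain μ c ρ x) ∂(μ.withDensity fun x => ENNReal.ofReal (ρ x)) := by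
  -- The logarithm of the coarse-grained density depends only on the cell, so its mean is the same
  -- under both densities.
  have h := integrable_comp_cell_iff (P := μ.withDensity fun x => ENNReal.ofReal (ρ x))
    (Q := μ.withDensity fun x => ENNReal.ofReal (coarseGrain μ c ρ x)) hc hc (fun k => by
      rw [withDensity_coarseGrain_cell hc hfin hρ0 hρ, withDensity_apply _ (hc k),
        ofReal_integral_eq_lintegral_ofReal hρ.integrableOn (Eventually.of_forall hρ0)])
    (fun k => -Real.log (⨍ y in c ⁻¹' {k}, ρ y ∂μ))
  have hm := measurable_coarseGrain (μ := μ) hc ρ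
  have hn : (fun x => Real.negMulLog (coarseGrain μ c ρ x)) =
      fun x => coarseGrain μ c ρ x * -Real.log (coarseGrain μ c ρ x) := by
    funext x; rw [Real.negMulLog]; ring
  rw [hn, ← integrable_withDensity_ofReal_iff hm (coarseGrain_nonneg hρ0),
    ← integral_withDensity_ofReal hm (coarseGrain_nonneg hρ0)]
  exact ⟨h.1.symm, h.2.symm⟩

/-- The function -x log x is not Lipschitz at 0, hence the additive `e`. Uniform continuity handles
nearby arguments; for arguments at least `d` apart, boundedness gives the linear term. -/
lemma exists_abs_negMulLog_sub_le (M : ℝ) {e : ℝ} (he : 0 < e) :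
    ∃ C, 0 ≤ C ∧ ∀ a ∈ Set.Icc 0 M, ∀ b ∈ Set.Icc 0 M,
      |Real.negMulLog a - Real.negMulLog b| ≤ e + C * |a - b| := by
  have hcont := (Real.continuous_negMulLog).continuousOn (s := Set.Icc 0 M)
  obtain ⟨B, hB⟩ := isCompact_Icc.exists_bound_of_continuousOn hcont
  obtain ⟨d, hd, huc⟩ := Metric.uniformContinuousOn_iff.1
    (isCompact_Icc.uniformContinuousOn_of_continuous hcont) e he
  refine ⟨2 * |B| / d, by positivity, fun a ha b hb => ?_⟩
  rcases lt_or_ge |a - b| d with h | h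
  · have := huc a ha b hb h
    rw [Real.dist_eq] at this
    have h0 : 0 ≤ 2 * |B| / d * |a - b| := by positivity
    linarith
  · have h1 : |Real.negMulLog a - Real.negMulLog b| ≤ 2 * |B| := by
      have h2 := abs_sub (Real.negMulLog a) (Real.negMulLog b)
      have h3 := hB a ha
      have h4 := hB b hb
      rw [Real.norm_eq_abs] at h3 h4
      linarith [le_abs_self B]
    have h5 : 2 * |B| ≤ 2 * |B| / d * |a - b| := by
      rw [div_mul_eq_mul_div, le_div_iff₀ hd]
      exact mul_le_mul_of_nonneg_left h (by positivity)
    linarith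

/-! ### The thermostated process: its law and its cell probabilities -/

namespace DrivenSystemWithBath

variable {n m : ℕ} {ι : Type*} {S : DrivenSystemWithBath n m ι}
  {U : ℝ → ℝ → PhaseSpace n × PhaseSpace m → PhaseSpace n × PhaseSpace m}
  {T ε δ : ℝ} {η : ℝ → ℝ≥0} {A : ι} {k : ℤ}

/-- A regular driven system in contact with a thermostat, together with its evolution and an
initial Boltzmann state. -/
structure ThermalRun (S : DrivenSystemWithBath n m ι)
    (U : ℝ → ℝ → PhaseSpace n × PhaseSpace m → PhaseSpace n × PhaseSpace m)
    (T ε δ : ℝ) (η : ℝ → ℝ≥0) (A : ι) (k : ℤ) : Prop where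
  regular : S.Regular
  evolution : S.IsEvolution U
  T_pos : 0 < T
  nonempty : (S.shellSet k).Nonempty
  thermostated : S.Thermostated U T ε δ η A k
  finite : S.FiniteAverages U A k

/-- The probability distribution of the micro-state at time `t`. -/
noncomputable def law (S : DrivenSystemWithBath n m ι)
    (U : ℝ → ℝ → PhaseSpace n × PhaseSpace m → PhaseSpace n × PhaseSpace m)
    (A : ι) (k : ℤ) (t : ℝ) : Measure (PhaseSpace n × PhaseSpace m) :=
  S.jointMeasure.withDensity fun z => ENNReal.ofReal (S.density U A k t z)

/-- The coarse-grained density of system plus bath. -/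
noncomputable def jointDensity (S : DrivenSystemWithBath n m ι)
    (U : ℝ → ℝ → PhaseSpace n × PhaseSpace m → PhaseSpace n × PhaseSpace m)
    (A : ι) (k : ℤ) (t : ℝ) : PhaseSpace n × PhaseSpace m → ℝ :=
  coarseGrain S.jointMeasure S.jointCell (S.density U A k t)

/-- The entropy of the coarse-grained density of system plus bath. -/
noncomputable def jointEntropy (S : DrivenSystemWithBath n m ι)
    (U : ℝ → ℝ → PhaseSpace n × PhaseSpace m → PhaseSpace n × PhaseSpace m)
    (A : ι) (k : ℤ) (t : ℝ) : ℝ :=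
  ∫ z, Real.negMulLog (S.jointDensity U A k t z) ∂S.jointMeasure

lemma jointCell_preimage (b : ι × ℤ) :
    S.jointCell ⁻¹' {b} = S.cellSet b.1 ×ˢ S.shellSet b.2 := by
  ext z
  simp [jointCell, cellSet, shellSet, Prod.ext_iff]

instance (h : ℝ) (n : ℕ) : SFinite (liouville h n) := by unfold liouville; infer_instance

namespace Regular

variable (hS : S.Regular)
include hS

lemma measurable_shell : Measurable S.shell :=
  Int.measurable_floor.comp (hS.contDiff_Hb.continuous.measurable.div_const _)

lemma measurableSet_shellSet (j : ℤ) : MeasurableSet (S.shellSet j) :=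
  hS.measurable_shell (measurableSet_singleton j)

lemma measurableSet_jointCell (b : ι × ℤ) : MeasurableSet (S.jointCell ⁻¹' {b}) := by
  rw [jointCell_preimage]
  exact (hS.measurableSet_cellSet _).prod (hS.measurableSet_shellSet _)

lemma jointMeasure_prod (B : ι) (j : ℤ) : S.jointMeasure (S.cellSet B ×ˢ S.shellSet j) =
    liouville S.h n (S.cellSet B) * liouville S.h m (S.shellSet j) := by
  rw [jointMeasure_eq hS, Measure.prod_prod]

lemma shell_mul_le (y : PhaseSpace m) : S.shell y * S.width ≤ S.Hb y := by
  have h := Int.floor_le (S.Hb y / S.width)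
  rwa [le_div_iff₀ hS.width_pos] at h

lemma le_shell_mul_add (y : PhaseSpace m) : S.Hb y ≤ S.shell y * S.width + S.width := by
  have h := (Int.lt_floor_add_one (S.Hb y / S.width)).le
  rw [div_le_iff₀ hS.width_pos] at h
  have : (⌊S.Hb y / S.width⌋ : ℝ) = S.shell y := rfl
  rw [this] at h
  linarith

end Regular

lemma IdealBath.measure_shellSet_ne_top (h : S.IdealBath T) (j : ℤ) :
    liouville S.h m (S.shellSet j) ≠ ∞ := by
  obtain ⟨s₀, h⟩ := h
  rcases (S.shellSet j).eq_empty_or_nonempty with he | hne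
  · simp [he]
  · rw [h j hne]; exact ENNReal.ofReal_ne_top

lemma IdealBath.measure_shellSet_ne_zero (h : S.IdealBath T) {j : ℤ}
    (hj : (S.shellSet j).Nonempty) : liouville S.h m (S.shellSet j) ≠ 0 := by
  obtain ⟨s₀, h⟩ := h
  rw [h j hj]
  simp [Real.exp_pos]

namespace ThermalRun

variable (h : S.ThermalRun U T ε δ η A k)
include h

lemma jointCell_ne_top (b : ι × ℤ) : S.jointMeasure (S.jointCell ⁻¹' {b}) ≠ ∞ := by
  rw [jointCell_preimage, h.regular.jointMeasure_prod]
  exact ENNReal.mul_ne_top (h.regular.volume_lt_top _).ne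
    (h.thermostated.ideal_bath.measure_shellSet_ne_top _)

lemma initial_ne_top : S.jointMeasure (S.cellSet A ×ˢ S.shellSet k) ≠ ∞ := by
  have := h.jointCell_ne_top (A, k)
  rwa [jointCell_preimage] at this

lemma initial_ne_zero : S.jointMeasure (S.cellSet A ×ˢ S.shellSet k) ≠ 0 := by
  rw [h.regular.jointMeasure_prod]
  exact mul_ne_zero (h.regular.volume_pos _).ne'
    (h.thermostated.ideal_bath.measure_shellSet_ne_zero h.nonempty)

lemma initial_real_pos : 0 < S.jointMeasure.real (S.cellSet A ×ˢ S.shellSet k) :=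
  ENNReal.toReal_pos h.initial_ne_zero h.initial_ne_top

lemma measurableSet_initial : MeasurableSet (S.cellSet A ×ˢ S.shellSet k) :=
  (h.regular.measurableSet_cellSet _).prod (h.regular.measurableSet_shellSet _)

lemma measurable_initialDensity : Measurable (S.initialDensity A k) :=
  measurable_const.indicator h.measurableSet_initial

lemma initialDensity_mem_Icc (z : PhaseSpace n × PhaseSpace m) : S.initialDensity A k z ∈
    Set.Icc 0 (S.jointMeasure.real (S.cellSet A ×ˢ S.shellSet k))⁻¹ := by
  have := (inv_pos.2 h.initial_real_pos).le
  unfold initialDensity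
  by_cases hz : z ∈ S.cellSet A ×ˢ S.shellSet k
  · rw [Set.indicator_of_mem hz]; exact ⟨this, le_rfl⟩
  · rw [Set.indicator_of_notMem hz]; exact ⟨le_rfl, this⟩

lemma integrable_initialDensity : Integrable (S.initialDensity A k) S.jointMeasure :=
  (integrableOn_const h.initial_ne_top).integrable_indicator h.measurableSet_initial

lemma integral_initialDensity : ∫ z, S.initialDensity A k z ∂S.jointMeasure = 1 := by
  unfold initialDensity
  rw [integral_indicator h.measurableSet_initial, setIntegral_const, smul_eq_mul]
  exact mul_inv_cancel₀ h.initial_real_pos.ne'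

/-- Evolution only transports the values of the density, so the initial bound persists. This is what
bounds the entropy from below by its initial value. -/
lemma density_mem_Icc (t : ℝ) (z : PhaseSpace n × PhaseSpace m) : S.density U A k t z ∈
    Set.Icc 0 (S.jointMeasure.real (S.cellSet A ×ˢ S.shellSet k))⁻¹ :=
  h.initialDensity_mem_Icc _

lemma density_nonneg (t : ℝ) (z : PhaseSpace n × PhaseSpace m) : 0 ≤ S.density U A k t z :=
  (h.density_mem_Icc t z).1

lemma density_zero : S.density U A k 0 = S.initialDensity A k := by
  funext z
  rw [density, evolveDensity, h.evolution.isFlow.init 0 le_rfl]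

variable {t : ℝ} (ht : 0 ≤ t)
include ht

lemma measurePreserving_back : MeasurePreserving (U t 0) S.jointMeasure S.jointMeasure :=
  h.evolution.measurePreserving h.regular ht le_rfl

lemma measurePreserving_forth : MeasurePreserving (U 0 t) S.jointMeasure S.jointMeasure :=
  h.evolution.measurePreserving h.regular le_rfl ht

lemma measurable_density : Measurable (S.density U A k t) :=
  h.measurable_initialDensity.comp (h.measurePreserving_back ht).measurable

lemma density_evolution (z : PhaseSpace n × PhaseSpace m) :
    S.density U A k t (U 0 t z) = S.initialDensity A k z := by
  rw [density, evolveDensity,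
    h.evolution.isFlow.leftInverse h.regular.contDiff_hamiltonField le_rfl ht]

lemma integrable_density : Integrable (S.density U A k t) S.jointMeasure :=
  (h.measurePreserving_back ht).integrable_comp_of_integrable h.integrable_initialDensity

lemma measurableEmbedding_forth : MeasurableEmbedding (U 0 t) :=
  h.evolution.isFlow.measurableEmbedding h.regular.contDiff_hamiltonField le_rfl ht

/-- Change of variables by the volume-preserving evolution: averaging over the evolved density
equals averaging the evolved observable over the initial one. -/
lemma integrable_law_iff (G : PhaseSpace n × PhaseSpace m → ℝ) :
    (Integrable G (S.law U A k t) ↔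
      Integrable (fun z => S.initialDensity A k z * G (U 0 t z)) S.jointMeasure) ∧
    ∫ z, G z ∂S.law U A k t =
      ∫ z, S.initialDensity A k z * G (U 0 t z) ∂S.jointMeasure := by
  rw [law, integrable_withDensity_ofReal_iff (h.measurable_density ht) (h.density_nonneg t),
    integral_withDensity_ofReal (h.measurable_density ht) (h.density_nonneg t)]
  have e1 := (h.measurePreserving_forth ht).integrable_comp_emb (h.measurableEmbedding_forth ht)
    (g := fun z => S.density U A k t z * G z)
  have e2 := (h.measurePreserving_forth ht).integral_comp (h.measurableEmbedding_forth ht)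
    (fun z => S.density U A k t z * G z)
  have e3 : (fun z => S.density U A k t z * G z) ∘ (U 0 t) =
      fun z => S.initialDensity A k z * G (U 0 t z) := by
    funext z; simp only [Function.comp_apply, h.density_evolution ht]
  rw [e3] at e1
  simp only [h.density_evolution ht] at e2
  exact ⟨e1.symm, e2.symm⟩

lemma isProbabilityMeasure_law : IsProbabilityMeasure (S.law U A k t) := by
  constructor
  rw [law, withDensity_apply _ MeasurableSet.univ, Measure.restrict_univ,
    ← ofReal_integral_eq_lintegral_ofReal (h.integrable_density ht)
      (Eventually.of_forall (h.density_nonneg t))]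
  have e2 := (h.measurePreserving_forth ht).integral_comp (h.measurableEmbedding_forth ht)
    (S.density U A k t)
  simp only [h.density_evolution ht] at e2
  rw [← e2, h.integral_initialDensity, ENNReal.ofReal_one]

lemma law_apply {s : Set (PhaseSpace n × PhaseSpace m)} (hs : MeasurableSet s) :
    S.law U A k t s = ENNReal.ofReal (∫ z in s, S.density U A k t z ∂S.jointMeasure) := by
  rw [law, withDensity_apply _ hs, ofReal_integral_eq_lintegral_ofReal
    (h.integrable_density ht).integrableOn (Eventually.of_forall (h.density_nonneg t))]

lemma law_jointCell (b : ι × ℤ) :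
    S.law U A k t (S.jointCell ⁻¹' {b}) = ENNReal.ofReal (S.jointProb U A k t b.1 b.2) := by
  rw [h.law_apply ht (h.regular.measurableSet_jointCell b), jointCell_preimage]; rfl

omit ht in
lemma measurableSet_cell_fst (B : ι) : MeasurableSet
    ((fun z : PhaseSpace n × PhaseSpace m => S.cell z.1) ⁻¹' {B}) :=
  measurable_fst (h.regular.measurableSet_cellSet B)

lemma law_cell (B : ι) : S.law U A k t ((fun z => S.cell z.1) ⁻¹' {B}) =
    ENNReal.ofReal (S.cellProb U A k t B) := by
  rw [h.law_apply ht (h.measurableSet_cell_fst B)]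
  have : (fun z : PhaseSpace n × PhaseSpace m => S.cell z.1) ⁻¹' {B} =
    S.cellSet B ×ˢ Set.univ := by ext z; simp [cellSet]
  rw [this]; rfl

omit ht in
lemma jointProb_nonneg (B : ι) (j : ℤ) : 0 ≤ S.jointProb U A k t B j :=
  integral_nonneg (h.density_nonneg t)

omit ht in
lemma cellProb_nonneg (B : ι) : 0 ≤ S.cellProb U A k t B :=
  integral_nonneg (h.density_nonneg t)

lemma jointProb_le_cellProb (B : ι) (j : ℤ) : S.jointProb U A k t B j ≤ S.cellProb U A k t B :=
  setIntegral_mono_set (h.integrable_density ht).integrableOn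
    (Eventually.of_forall (h.density_nonneg t))
    (Set.prod_mono le_rfl (Set.subset_univ _)).eventuallyLE

omit ht in
lemma jointDensity_eq (z : PhaseSpace n × PhaseSpace m) : S.jointDensity U A k t z =
    S.jointProb U A k t (S.cell z.1) (S.shell z.2) /
      ((liouville S.h n).real (S.cellSet (S.cell z.1)) *
        (liouville S.h m).real (S.shellSet (S.shell z.2))) := by
  rw [jointDensity, coarseGrain, setAverage_eq, smul_eq_mul, inv_mul_eq_div, jointCell_preimage,
    measureReal_def, h.regular.jointMeasure_prod, ENNReal.toReal_mul]
  rfl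

lemma setIntegral_marginal (B : ι) :
    ∫ x in S.cellSet B, (∫ y, S.density U A k t (x, y) ∂(liouville S.h m)) ∂(liouville S.h n) =
      S.cellProb U A k t B := by
  have hint : Integrable (S.density U A k t) ((liouville S.h n).prod (liouville S.h m)) :=
    jointMeasure_eq h.regular ▸ h.integrable_density ht
  rw [cellProb, jointMeasure_eq h.regular, setIntegral_prod _ hint.integrableOn]
  simp only [Measure.restrict_univ]

lemma integrable_marginal :
    Integrable (fun x => ∫ y, S.density U A k t (x, y) ∂(liouville S.h m)) (liouville S.h n) := by
  have hint : Integrable (S.density U A k t) ((liouville S.h n).prod (liouville S.h m)) :=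
    jointMeasure_eq h.regular ▸ h.integrable_density ht
  exact hint.integral_prod_left

lemma systemDensity_eq (x : PhaseSpace n) : S.systemDensity U A k t x =
    S.cellProb U A k t (S.cell x) / (liouville S.h n).real (S.cellSet (S.cell x)) := by
  rw [← h.setIntegral_marginal ht, systemDensity, coarseGrain, setAverage_eq, smul_eq_mul,
    inv_mul_eq_div]
  rfl

omit ht in
lemma systemDensity_nonneg (x : PhaseSpace n) : 0 ≤ S.systemDensity U A k t x :=
  coarseGrain_nonneg (fun x => integral_nonneg fun y => h.density_nonneg t (x, y)) x

variable [Countable ι]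

omit ht in
lemma measurable_systemDensity : Measurable (S.systemDensity U A k t) :=
  measurable_coarseGrain h.regular.measurableSet_cellSet _

/-- Neither integrating out the bath, by Fubini, nor averaging over Boltzmann cells changes the
probability of a cell. -/
lemma systemLaw_cell (B : ι) :
    (liouville S.h n).withDensity (fun x => ENNReal.ofReal (S.systemDensity U A k t x))
      (S.cell ⁻¹' {B}) = S.law U A k t ((fun z => S.cell z.1) ⁻¹' {B}) := by
  rw [h.law_cell ht, ← h.setIntegral_marginal ht]
  exact withDensity_coarseGrain_cell h.regular.measurableSet_cellSet
    (fun B => (h.regular.volume_lt_top B).ne)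
    (fun x => integral_nonneg fun y => h.density_nonneg t (x, y)) (h.integrable_marginal ht) B

lemma isProbabilityMeasure_systemLaw : IsProbabilityMeasure
    ((liouville S.h n).withDensity fun x => ENNReal.ofReal (S.systemDensity U A k t x)) := by
  have := h.isProbabilityMeasure_law ht
  constructor
  have e1 := lintegral_comp_cell
    (P := (liouville S.h n).withDensity fun x => ENNReal.ofReal (S.systemDensity U A k t x))
    (c := S.cell) h.regular.measurableSet_cellSet (fun _ => 1)
  have e2 := lintegral_comp_cell (P := S.law U A k t)
    (c := fun z : PhaseSpace n × PhaseSpace m => S.cell z.1) h.measurableSet_cell_fst (fun _ => 1)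
  rw [lintegral_one] at e1 e2
  rw [e1]
  simp_rw [h.systemLaw_cell ht]
  rw [← e2, measure_univ]

/-- Averages of functions of the Boltzmann cell with the coarse-grained density of the system. -/
lemma integrable_systemDensity_iff (g : ι → ℝ) :
    (Integrable (fun x => S.systemDensity U A k t x * g (S.cell x)) (liouville S.h n) ↔
      Integrable (fun z : PhaseSpace n × PhaseSpace m => g (S.cell z.1)) (S.law U A k t)) ∧
    ∫ x, S.systemDensity U A k t x * g (S.cell x) ∂(liouville S.h n) =
      ∫ z, g (S.cell z.1) ∂(S.law U A k t) := by
  have hm := h.measurable_systemDensity (t := t)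
  rw [← integrable_withDensity_ofReal_iff hm h.systemDensity_nonneg (fun x => g (S.cell x)),
    ← integral_withDensity_ofReal hm h.systemDensity_nonneg (fun x => g (S.cell x))]
  exact integrable_comp_cell_iff (c := S.cell) (c' := fun z : PhaseSpace n × PhaseSpace m => S.cell z.1)
    h.regular.measurableSet_cellSet h.measurableSet_cell_fst (h.systemLaw_cell ht) g

end ThermalRun

end DrivenSystemWithBath

/-! ### Balance of energy and entropy -/

namespace DrivenSystemWithBath

variable {n m : ℕ} {ι : Type*} {S : DrivenSystemWithBath n m ι}
  {U : ℝ → ℝ → PhaseSpace n × PhaseSpace m → PhaseSpace n × PhaseSpace m}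
  {T ε δ : ℝ} {η : ℝ → ℝ≥0} {A : ι} {k : ℤ}

/-- The lower edge of the energies in a Boltzmann cell. -/
noncomputable def cellEnergy (S : DrivenSystemWithBath n m ι) (B : ι) : ℝ :=
  sInf (S.H '' S.cellSet B)

lemma Thermostated.cellEnergy_le (h : S.Thermostated U T ε δ η A k) (x : PhaseSpace n) :
    S.cellEnergy (S.cell x) ≤ S.H x := by
  refine csInf_le ⟨S.H x - ε, ?_⟩ ⟨x, rfl, rfl⟩
  rintro _ ⟨x', hx', rfl⟩
  have := (abs_le.1 (h.energy_resolution x x' (Eq.symm hx'))).2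
  linarith

lemma Thermostated.le_cellEnergy_add (h : S.Thermostated U T ε δ η A k) (x : PhaseSpace n) :
    S.H x ≤ S.cellEnergy (S.cell x) + ε := by
  rw [← sub_le_iff_le_add]
  refine le_csInf ⟨_, x, rfl, rfl⟩ ?_
  rintro _ ⟨x', hx', rfl⟩
  have := (abs_le.1 (h.energy_resolution x x' (Eq.symm hx'))).2
  linarith

namespace ThermalRun

variable [Countable ι] (h : S.ThermalRun U T ε δ η A k)
include h

lemma measurable_cellEnergy : Measurable fun x => S.cellEnergy (S.cell x) :=
  measurable_comp_cell h.regular.measurableSet_cellSet _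

lemma integrable_sub_cellEnergy {Γ : Type*} [MeasurableSpace Γ] {P : Measure Γ}
    [IsFiniteMeasure P] {g : Γ → PhaseSpace n} (hg : Measurable g) :
    Integrable (fun z => S.H (g z) - S.cellEnergy (S.cell (g z))) P := by
  refine Integrable.of_bound (C := ε) ((h.regular.contDiff_H.continuous.measurable.comp hg).sub
    (h.measurable_cellEnergy.comp hg)).aestronglyMeasurable (Eventually.of_forall fun z => ?_)
  rw [Real.norm_eq_abs, abs_le]
  have h1 := h.thermostated.cellEnergy_le (g z)
  have h2 := h.thermostated.le_cellEnergy_add (g z)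
  constructor <;> linarith

variable {t : ℝ} (ht : 0 ≤ t)
include ht

/-- Integrability of the energy is assumed only for the coarse-grained density. A function of the
cell that stays within `ε` of the energy carries it over to the law of the micro-state. -/
lemma integrable_cellEnergy :
    Integrable (fun x => S.systemDensity U A k t x * S.cellEnergy (S.cell x))
      (liouville S.h n) := by
  have := h.isProbabilityMeasure_systemLaw ht
  have hm := h.measurable_systemDensity (t := t)
  have h1 := (integrable_withDensity_ofReal_iff hm h.systemDensity_nonneg _).2
    (h.finite.energy t ht)
  have h2 := h1.sub (h.integrable_sub_cellEnergy (g := fun x => x) measurable_id)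
  refine (integrable_withDensity_ofReal_iff hm h.systemDensity_nonneg _).1 (h2.congr ?_)
  exact Eventually.of_forall fun x => by simp

lemma integrable_H_law : Integrable (fun z => S.H z.1) (S.law U A k t) := by
  have := h.isProbabilityMeasure_law ht
  have h1 := (h.integrable_systemDensity_iff ht S.cellEnergy).1.1 (h.integrable_cellEnergy ht)
  have h2 := h1.add (h.integrable_sub_cellEnergy (P := S.law U A k t) (g := fun z => z.1)
    measurable_fst)
  exact h2.congr (Eventually.of_forall fun x => by simp)

/-- Coarse-graining changes the average energy of the system by at most `ε`. -/
lemma abs_energy_sub_le :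
    |∫ x, S.systemDensity U A k t x * S.H x ∂(liouville S.h n) -
      ∫ z, S.H z.1 ∂(S.law U A k t)| ≤ ε := by
  have hP := h.isProbabilityMeasure_law ht
  have hQ := h.isProbabilityMeasure_systemLaw ht
  have hm := h.measurable_systemDensity (t := t)
  have hT := h.thermostated
  have e := h.integrable_systemDensity_iff ht S.cellEnergy
  have i1 := e.1.1 (h.integrable_cellEnergy ht)
  have i2 := h.integrable_H_law ht
  have i3 := (integrable_withDensity_ofReal_iff hm h.systemDensity_nonneg _).2
    (h.integrable_cellEnergy ht)
  have i4 := (integrable_withDensity_ofReal_iff hm h.systemDensity_nonneg _).2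
    (h.finite.energy t ht)
  have e2 := e.2
  rw [← integral_withDensity_ofReal hm h.systemDensity_nonneg] at e2 ⊢
  -- Both means lie in the interval of length `ε` that begins at the common mean of the cell energy.
  have a1 := integral_mono i1 i2 (fun z => hT.cellEnergy_le z.1)
  have a2 := integral_mono i2 (i1.add (integrable_const ε)) (fun z => hT.le_cellEnergy_add z.1)
  have a3 := integral_mono i3 i4 (fun x => hT.cellEnergy_le x)
  have a4 := integral_mono i4 (i3.add (integrable_const ε)) (fun x => hT.le_cellEnergy_add x)
  simp only [Pi.add_apply] at a2 a4
  rw [integral_add i1 (integrable_const ε), integral_const, probReal_univ, one_smul] at a2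
  rw [integral_add i3 (integrable_const ε), integral_const, probReal_univ, one_smul] at a4
  rw [abs_le]
  constructor <;> linarith

omit [Countable ι] in
lemma integrable_Hint_law : Integrable S.Hint (S.law U A k t) := by
  have := h.isProbabilityMeasure_law ht
  exact Integrable.of_bound h.regular.contDiff_Hint.continuous.measurable.aestronglyMeasurable δ
    (Eventually.of_forall fun z => h.thermostated.weak_interaction z)

omit [Countable ι] in
lemma abs_integral_Hint_le : |∫ z, S.Hint z ∂(S.law U A k t)| ≤ δ := by
  have := h.isProbabilityMeasure_law ht
  have := norm_integral_le_of_norm_le_const (μ := S.law U A k t) (f := S.Hint) (C := δ)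
    (Eventually.of_forall fun z => h.thermostated.weak_interaction z)
  simpa using this

omit ht in
-- Initially the bath is in a single shell, where its energy is bounded. Integrability at later
-- times, also of the bath energy, follows from this together with that of the work.
lemma integrable_Htot_law_zero : Integrable S.Htot (S.law U A k 0) := by
  have hP := h.isProbabilityMeasure_law le_rfl
  have hHb : Integrable (fun z : PhaseSpace n × PhaseSpace m => S.Hb z.2) (S.law U A k 0) := by
    rw [law, h.density_zero, integrable_withDensity_ofReal_iff h.measurable_initialDensity
      (fun z => (h.initialDensity_mem_Icc z).1)]
    have hmeas : Measurable fun z : PhaseSpace n × PhaseSpace m => S.Hb z.2 :=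
      h.regular.contDiff_Hb.continuous.measurable.comp measurable_snd
    refine (h.integrable_initialDensity.mul_const (|(k : ℝ) * S.width| + S.width)).mono'
      (h.measurable_initialDensity.mul hmeas).aestronglyMeasurable
      (Eventually.of_forall fun z => ?_)
    have h0 := (h.initialDensity_mem_Icc z).1
    rw [norm_mul, Real.norm_of_nonneg h0]
    by_cases hz : z ∈ S.cellSet A ×ˢ S.shellSet k
    · refine mul_le_mul_of_nonneg_left ?_ h0
      have hk : S.shell z.2 = k := hz.2
      have h1 := h.regular.shell_mul_le z.2
      have h2 := h.regular.le_shell_mul_add z.2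
      rw [hk] at h1 h2
      have := h.regular.width_pos
      rw [Real.norm_eq_abs, abs_le]
      constructor
      · linarith [neg_abs_le ((k : ℝ) * S.width)]
      · linarith [le_abs_self ((k : ℝ) * S.width)]
    · simp [initialDensity, hz]
  exact ((h.integrable_H_law le_rfl).add hHb).add (h.integrable_Hint_law le_rfl)

lemma integrable_Htot_comp :
    Integrable (fun z => S.initialDensity A k z * S.Htot (U 0 t z)) S.jointMeasure ∧
    Integrable (fun z => S.initialDensity A k z * S.Htot z) S.jointMeasure := by
  have h0 := (h.integrable_law_iff le_rfl S.Htot).1.1 h.integrable_Htot_law_zero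
  have hid : ∀ z, U 0 0 z = z := h.evolution.isFlow.init 0 le_rfl
  simp only [hid] at h0
  refine ⟨?_, h0⟩
  refine ((h.finite.work t ht).add h0).congr (Eventually.of_forall fun z => ?_)
  simp only [Pi.add_apply, h.evolution.work_eq h.regular ht]
  ring

lemma integrable_Htot_law : Integrable S.Htot (S.law U A k t) :=
  (h.integrable_law_iff ht S.Htot).1.2 (h.integrable_Htot_comp ht).1

lemma averageWork_eq : S.averageWork U A k t =
    ∫ z, S.Htot z ∂(S.law U A k t) - ∫ z, S.Htot z ∂(S.law U A k 0) := by
  have hid : ∀ z, U 0 0 z = z := h.evolution.isFlow.init 0 le_rfl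
  rw [(h.integrable_law_iff ht S.Htot).2, (h.integrable_law_iff le_rfl S.Htot).2]
  simp only [hid]
  rw [← integral_sub (h.integrable_Htot_comp ht).1 (h.integrable_Htot_comp ht).2, averageWork]
  refine integral_congr_ae (Eventually.of_forall fun z => ?_)
  simp only [h.evolution.work_eq h.regular ht]
  ring

lemma integrable_Hb_law : Integrable (fun z => S.Hb z.2) (S.law U A k t) :=
  (((h.integrable_Htot_law ht).sub (h.integrable_H_law ht)).sub (h.integrable_Hint_law ht)).congr
    (Eventually.of_forall fun z => by simp only [Pi.sub_apply, Htot]; ring)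

lemma integral_Htot_law : ∫ z, S.Htot z ∂(S.law U A k t) =
    ∫ z, S.H z.1 ∂(S.law U A k t) + ∫ z, S.Hb z.2 ∂(S.law U A k t) +
      ∫ z, S.Hint z ∂(S.law U A k t) := by
  have hi : Integrable (fun z => S.H z.1 + S.Hb z.2) (S.law U A k t) :=
    (h.integrable_H_law ht).add (h.integrable_Hb_law ht)
  rw [← integral_add (h.integrable_H_law ht) (h.integrable_Hb_law ht), ← integral_add
    hi (h.integrable_Hint_law ht)]
  rfl

lemma integrable_shell_law :
    Integrable (fun z : PhaseSpace n × PhaseSpace m => (S.shell z.2 : ℝ) * S.width)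
      (S.law U A k t) := by
  have := h.isProbabilityMeasure_law ht
  have hm : Measurable fun z : PhaseSpace n × PhaseSpace m => (S.shell z.2 : ℝ) * S.width :=
    ((measurable_from_top (f := ((↑) : ℤ → ℝ))).comp
      (h.regular.measurable_shell.comp measurable_snd)).mul_const _
  refine ((h.integrable_Hb_law ht).norm.add (integrable_const S.width)).mono'
    hm.aestronglyMeasurable (Eventually.of_forall fun z => ?_)
  have h1 := h.regular.shell_mul_le z.2
  have h2 := h.regular.le_shell_mul_add z.2
  have := h.regular.width_pos
  simp only [Pi.add_apply, Real.norm_eq_abs]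
  rw [abs_le]
  constructor
  · linarith [neg_abs_le (S.Hb z.2)]
  · linarith [le_abs_self (S.Hb z.2)]

lemma integral_Hb_mem_Icc : ∫ z, S.Hb z.2 ∂(S.law U A k t) ∈
    Set.Icc (∫ z, (S.shell z.2 : ℝ) * S.width ∂(S.law U A k t))
      (∫ z, (S.shell z.2 : ℝ) * S.width ∂(S.law U A k t) + S.width) := by
  have := h.isProbabilityMeasure_law ht
  refine ⟨integral_mono (h.integrable_shell_law ht) (h.integrable_Hb_law ht)
    fun z => h.regular.shell_mul_le z.2, ?_⟩
  have := integral_mono (h.integrable_Hb_law ht)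
    ((h.integrable_shell_law ht).add (integrable_const S.width))
    fun z => h.regular.le_shell_mul_add z.2
  simp only [Pi.add_apply] at this
  rwa [integral_add (h.integrable_shell_law ht) (integrable_const _), integral_const,
    probReal_univ, one_smul] at this

omit [Countable ι] in
lemma log_cond_eq (B : ι) (j : ℤ) :
    S.cellProb U A k t B * Real.negMulLog (S.jointProb U A k t B j / S.cellProb U A k t B) =
      S.jointProb U A k t B j *
        -Real.log (S.jointProb U A k t B j / S.cellProb U A k t B) := by
  -- A cell of probability zero makes the joint probability vanish too, so both sides are 0 despite
  -- the division by zero.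
  rcases (h.cellProb_nonneg (t := t) B).eq_or_lt with h0 | h0
  · have h1 := h.jointProb_nonneg (t := t) B j
    have h2 := h.jointProb_le_cellProb ht B j
    have : S.jointProb U A k t B j = 0 := by linarith
    rw [this, ← h0]; simp
  · rw [Real.negMulLog]
    field_simp

/-- The average over the micro-states of the conditional entropy of the bath is the conditional
Shannon entropy. -/
lemma conditional_entropy :
    Integrable (fun z : PhaseSpace n × PhaseSpace m => -Real.log
      (S.jointProb U A k t (S.cell z.1) (S.shell z.2) / S.cellProb U A k t (S.cell z.1)))
      (S.law U A k t) ∧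
    ∫ z, -Real.log (S.jointProb U A k t (S.cell z.1) (S.shell z.2) /
      S.cellProb U A k t (S.cell z.1)) ∂(S.law U A k t) ∈ Set.Icc 0 (η t : ℝ) := by
  set g : ι × ℤ → ℝ := fun b => -Real.log (S.jointProb U A k t b.1 b.2 / S.cellProb U A k t b.1)
  have hg0 : ∀ b, 0 ≤ g b := fun b => neg_nonneg.2 <| Real.log_nonpos
    (div_nonneg (h.jointProb_nonneg _ _) (h.cellProb_nonneg _))
    (div_le_one_of_le₀ (h.jointProb_le_cellProb ht _ _) (h.cellProb_nonneg _))
  have hm : Measurable fun z => g (S.jointCell z) :=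
    measurable_comp_cell h.regular.measurableSet_jointCell g
  have hle : ∫⁻ z, ENNReal.ofReal (g (S.jointCell z)) ∂(S.law U A k t) ≤ η t := by
    refine le_trans (le_of_eq ?_) (h.thermostated.bath_equilibrium t ht)
    rw [lintegral_comp_cell h.regular.measurableSet_jointCell (fun b => ENNReal.ofReal (g b)),
      bathCondEntropy]
    refine tsum_congr fun b => ?_
    rw [h.law_jointCell ht, ← ENNReal.ofReal_mul (hg0 b), h.log_cond_eq ht, mul_comm]
  -- The integrand is non-negative, so the finite bound on the conditional entropy gives
  -- integrability rather than presupposing it.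
  have hint : Integrable (fun z => g (S.jointCell z)) (S.law U A k t) := by
    refine ⟨hm.aestronglyMeasurable, ?_⟩
    rw [hasFiniteIntegral_iff_ofReal (Eventually.of_forall fun z => hg0 _)]
    exact hle.trans_lt ENNReal.coe_lt_top
  refine ⟨hint, integral_nonneg fun z => hg0 (S.jointCell z), ?_⟩
  have h1 := ofReal_integral_eq_lintegral_ofReal hint (Eventually.of_forall fun z => hg0 _)
  rw [← h1, ENNReal.ofReal_le_coe] at hle
  exact hle

omit [Countable ι] in
lemma jointProb_pos_of_law_ne_zero {z : PhaseSpace n × PhaseSpace m}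
    (hz : S.law U A k t (S.jointCell ⁻¹' {S.jointCell z}) ≠ 0) :
    0 < S.jointProb U A k t (S.cell z.1) (S.shell z.2) := by
  rw [h.law_jointCell ht, ne_eq, ENNReal.ofReal_eq_zero, not_le] at hz
  exact hz

lemma ae_jointProb_pos : ∀ᵐ z ∂(S.law U A k t),
    0 < S.jointProb U A k t (S.cell z.1) (S.shell z.2) := by
  filter_upwards [ae_measure_cell_ne_zero (c := S.jointCell) (S.law U A k t)] with z hz
  exact h.jointProb_pos_of_law_ne_zero ht hz

omit ht [Countable ι] in
lemma cell_real_pos (B : ι) : 0 < (liouville S.h n).real (S.cellSet B) :=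
  ENNReal.toReal_pos (h.regular.volume_pos B).ne' (h.regular.volume_lt_top B).ne

omit ht [Countable ι] in
lemma shell_real_pos (y : PhaseSpace m) :
    0 < (liouville S.h m).real (S.shellSet (S.shell y)) :=
  ENNReal.toReal_pos (h.thermostated.ideal_bath.measure_shellSet_ne_zero ⟨y, rfl⟩)
    (h.thermostated.ideal_bath.measure_shellSet_ne_top _)

omit [Countable ι] in
/-- The entropy of a cell of the whole is composed of the entropy of the Boltzmann cell, the
conditional entropy of the bath and the Boltzmann entropy of the energy shell. -/
lemma log_jointDensity {s₀ : ℝ} (hs₀ : ∀ k : ℤ, (S.shellSet k).Nonempty →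
      liouville S.h m (S.shellSet k) = ENNReal.ofReal (Real.exp (s₀ + k * S.width / T)))
    {z : PhaseSpace n × PhaseSpace m} (hz : 0 < S.jointProb U A k t (S.cell z.1) (S.shell z.2)) :
    -Real.log (S.jointDensity U A k t z) =
      -Real.log (S.systemDensity U A k t z.1) +
      -Real.log (S.jointProb U A k t (S.cell z.1) (S.shell z.2) / S.cellProb U A k t (S.cell z.1)) +
      (s₀ + S.shell z.2 * S.width / T) := by
  have hp : 0 < S.cellProb U A k t (S.cell z.1) := hz.trans_le (h.jointProb_le_cellProb ht _ _)
  have hV := h.cell_real_pos (S.cell z.1)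
  have hW : Real.log ((liouville S.h m).real (S.shellSet (S.shell z.2))) =
      s₀ + S.shell z.2 * S.width / T := by
    rw [measureReal_def, hs₀ _ ⟨z.2, rfl⟩, ENNReal.toReal_ofReal (Real.exp_pos _).le,
      Real.log_exp]
  have hW' := h.shell_real_pos z.2
  rw [← hW, h.jointDensity_eq, h.systemDensity_eq ht, Real.log_div hz.ne' (by positivity),
    Real.log_mul hV.ne' hW'.ne', Real.log_div hp.ne' hV.ne', Real.log_div hz.ne' hp.ne']
  ring

lemma system_entropy :
    Integrable (fun z : PhaseSpace n × PhaseSpace m => -Real.log (S.systemDensity U A k t z.1))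
      (S.law U A k t) ∧
    ∫ x, S.systemDensity U A k t x * Real.log (S.systemDensity U A k t x) ∂(liouville S.h n) =
      -∫ z, -Real.log (S.systemDensity U A k t z.1) ∂(S.law U A k t) := by
  set g : ι → ℝ := fun B => Real.log (⨍ x in S.cell ⁻¹' {B},
    (∫ y, S.density U A k t (x, y) ∂(liouville S.h m)) ∂(liouville S.h n))
  have hg := h.integrable_systemDensity_iff ht g
  refine ⟨(hg.1.1 (h.finite.entropy t ht)).neg, ?_⟩
  rw [integral_neg, neg_neg]
  exact hg.2

/-- Decomposition of the entropy of the whole. -/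
lemma entropy_decomposition {s₀ : ℝ} (hs₀ : ∀ k : ℤ, (S.shellSet k).Nonempty →
      liouville S.h m (S.shellSet k) = ENNReal.ofReal (Real.exp (s₀ + k * S.width / T))) :
    Integrable (fun z => -Real.log (S.jointDensity U A k t z)) (S.law U A k t) ∧
    ∫ z, -Real.log (S.jointDensity U A k t z) ∂(S.law U A k t) =
      ∫ z, -Real.log (S.systemDensity U A k t z.1) ∂(S.law U A k t) +
      ∫ z, -Real.log (S.jointProb U A k t (S.cell z.1) (S.shell z.2) /
        S.cellProb U A k t (S.cell z.1)) ∂(S.law U A k t) +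
      (s₀ + (∫ z, (S.shell z.2 : ℝ) * S.width ∂(S.law U A k t)) / T) := by
  have := h.isProbabilityMeasure_law ht
  have i1 := (h.system_entropy ht).1
  have i2 := (h.conditional_entropy ht).1
  have i3 := (h.integrable_shell_law ht).div_const T
  have i4 : Integrable (fun z : PhaseSpace n × PhaseSpace m => s₀ + S.shell z.2 * S.width / T)
    (S.law U A k t) := (integrable_const s₀).add i3
  have i5 : Integrable (fun z => -Real.log (S.systemDensity U A k t z.1) +
      -Real.log (S.jointProb U A k t (S.cell z.1) (S.shell z.2) / S.cellProb U A k t (S.cell z.1)))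
    (S.law U A k t) := i1.add i2
  -- The logarithm of the product splits only on cells of positive probability, which is almost
  -- everywhere for the law.
  have hae : (fun z => -Real.log (S.jointDensity U A k t z)) =ᵐ[S.law U A k t]
      fun z => -Real.log (S.systemDensity U A k t z.1) +
      -Real.log (S.jointProb U A k t (S.cell z.1) (S.shell z.2) / S.cellProb U A k t (S.cell z.1)) +
      (s₀ + S.shell z.2 * S.width / T) := by
    filter_upwards [h.ae_jointProb_pos ht] with z hz using h.log_jointDensity ht hs₀ hz
  refine ⟨(i5.add i4).congr hae.symm, ?_⟩
  rw [integral_congr_ae hae, integral_add i5 i4, integral_add i1 i2,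
    integral_add (integrable_const _) i3, integral_const, probReal_univ, one_smul, integral_div]

lemma jointEntropy_eq : S.jointEntropy U A k t =
    ∫ z, -Real.log (S.jointDensity U A k t z) ∂(S.law U A k t) :=
  (integrable_negMulLog_coarseGrain_iff h.regular.measurableSet_jointCell h.jointCell_ne_top
    (h.density_nonneg t) (h.integrable_density ht)).2

/-- Finiteness of the entropy of the whole is not among the hypotheses; it follows because every
term of the decomposition is integrable. -/
lemma integrable_negMulLog_jointDensity :
    Integrable (fun z => Real.negMulLog (S.jointDensity U A k t z)) S.jointMeasure := by
  obtain ⟨s₀, hs₀⟩ := h.thermostated.ideal_bath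
  exact (integrable_negMulLog_coarseGrain_iff h.regular.measurableSet_jointCell h.jointCell_ne_top
    (h.density_nonneg t) (h.integrable_density ht)).1.2 (h.entropy_decomposition ht hs₀).1

lemma freeEnergy_eq : freeEnergy S.h S.H T (S.systemDensity U A k t) =
    ∫ x, S.systemDensity U A k t x * S.H x ∂(liouville S.h n) -
      T * ∫ z, -Real.log (S.systemDensity U A k t z.1) ∂(S.law U A k t) := by
  have h1 := (h.system_entropy ht).2
  rw [freeEnergy, sub_eq_add_neg, ← mul_neg, ← h1, ← integral_const_mul, ← integral_add
    (h.finite.energy t ht) ((h.finite.entropy t ht).const_mul T)]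
  refine integral_congr_ae (Eventually.of_forall fun x => ?_)
  simp only
  ring

/-- The excess work grows at least like the entropy of the whole, up to the tolerances. -/
lemma excessWork_le {τ : ℝ} (hτ : 0 ≤ τ) :
    S.excessWork U T A k τ + T * (S.jointEntropy U A k t - S.jointEntropy U A k τ) ≤
      S.excessWork U T A k t + (2 * ε + 2 * δ + S.width + T * η t) := by
  obtain ⟨s₀, hs₀⟩ := h.thermostated.ideal_bath
  have hT := h.T_pos
  have eS := (h.entropy_decomposition ht hs₀).2
  have eS' := (h.entropy_decomposition hτ hs₀).2
  have eN := (h.conditional_entropy ht).2.2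
  have eN' := (h.conditional_entropy hτ).2.1
  have eB := (h.integral_Hb_mem_Icc ht).1
  have eB' := (h.integral_Hb_mem_Icc hτ).2
  have eI := (abs_le.1 (h.abs_integral_Hint_le ht)).1
  have eI' := (abs_le.1 (h.abs_integral_Hint_le hτ)).2
  have eE := (abs_le.1 (h.abs_energy_sub_le ht)).2
  have eE' := (abs_le.1 (h.abs_energy_sub_le hτ)).1
  rw [← h.jointEntropy_eq ht] at eS
  rw [← h.jointEntropy_eq hτ] at eS'
  simp only [excessWork, freeEnergyChange, h.averageWork_eq ht, h.averageWork_eq hτ,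
    h.integral_Htot_law ht, h.integral_Htot_law hτ, h.freeEnergy_eq ht, h.freeEnergy_eq hτ]
  rw [eS, eS']
  -- Error budget: energy resolution and interaction enter at both times, giving 2ε + 2δ. The excess
  -- of the bath energy over its shell edge counts only at `τ`, giving one width. The conditional
  -- entropy counts only at `t`, since at `τ` it enters with the favourable sign.
  have hN := mul_le_mul_of_nonneg_left eN hT.le
  have hN' := mul_nonneg hT.le eN'
  have hd : ∀ a : ℝ, T * (a / T) = a := fun a => by field_simp
  simp only [mul_sub, mul_add, hd]
  linarith

end ThermalRun

end DrivenSystemWithBath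

/-! ### Growth of the entropy of the whole -/

namespace DrivenSystemWithBath

variable {n m : ℕ} {ι : Type*} {S : DrivenSystemWithBath n m ι}
  {U : ℝ → ℝ → PhaseSpace n × PhaseSpace m → PhaseSpace n × PhaseSpace m}
  {T ε δ : ℝ} {η : ℝ → ℝ≥0} {A : ι} {k : ℤ}

namespace ThermalRun

variable (h : S.ThermalRun U T ε δ η A k)
include h

lemma coarseGrain_initialDensity :
    coarseGrain S.jointMeasure S.jointCell (S.initialDensity A k) = S.initialDensity A k := by
  classical
  refine coarseGrain_of_const (a := fun b => if b = (A, k) then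
    (S.jointMeasure.real (S.cellSet A ×ˢ S.shellSet k))⁻¹ else 0)
    h.regular.measurableSet_jointCell (fun z => ?_) (fun z hz => ?_) h.jointCell_ne_top
  · have : z ∈ S.cellSet A ×ˢ S.shellSet k ↔ S.jointCell z = (A, k) := by
      rw [← jointCell_preimage (S := S) (A, k)]; rfl
    simp only [initialDensity, Set.indicator_apply, this]
  · have hz' : S.jointCell z = (A, k) := by
      by_contra hne
      simp [hne] at hz
    rw [hz', jointCell_preimage]
    exact h.initial_ne_zero

lemma jointDensity_mem_Icc (t : ℝ) (z : PhaseSpace n × PhaseSpace m) : S.jointDensity U A k t z ∈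
    Set.Icc 0 (S.jointMeasure.real (S.cellSet A ×ˢ S.shellSet k))⁻¹ :=
  coarseGrain_mem_Icc h.jointCell_ne_top (inv_pos.2 h.initial_real_pos).le (h.density_mem_Icc t) z

lemma jointEntropy_zero : S.jointEntropy U A k 0 =
    -Real.log (S.jointMeasure.real (S.cellSet A ×ˢ S.shellSet k))⁻¹ := by
  rw [jointEntropy, jointDensity, h.density_zero, h.coarseGrain_initialDensity]
  have : ∀ z, Real.negMulLog (S.initialDensity A k z) = S.initialDensity A k z *
      -Real.log (S.jointMeasure.real (S.cellSet A ×ˢ S.shellSet k))⁻¹ := fun z => by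
    by_cases hz : z ∈ S.cellSet A ×ˢ S.shellSet k
    · simp only [initialDensity, Set.indicator_of_mem hz, Real.negMulLog]; ring
    · simp [initialDensity, Set.indicator_of_notMem hz]
  simp_rw [this]
  rw [integral_mul_const, h.integral_initialDensity, one_mul]

variable [Countable ι] {t : ℝ} (ht : 0 ≤ t)
include ht

lemma integrable_jointDensity : Integrable (S.jointDensity U A k t) S.jointMeasure :=
  (h.integrable_density ht).coarseGrain h.regular.measurableSet_jointCell h.jointCell_ne_top

lemma integral_jointDensity : ∫ z, S.jointDensity U A k t z ∂S.jointMeasure = 1 := by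
  have e2 := (h.measurePreserving_forth ht).integral_comp (h.measurableEmbedding_forth ht)
    (S.density U A k t)
  simp only [h.density_evolution ht] at e2
  rw [← h.integral_initialDensity, e2]
  exact integral_coarseGrain h.regular.measurableSet_jointCell h.jointCell_ne_top
    (h.integrable_density ht)

/-- The entropy of the whole is never below its initial value. -/
lemma jointEntropy_zero_le : S.jointEntropy U A k 0 ≤ S.jointEntropy U A k t := by
  rw [h.jointEntropy_zero, ← one_mul (-Real.log _), ← h.integral_jointDensity ht,
    ← integral_mul_const]
  refine integral_mono ((h.integrable_jointDensity ht).mul_const _)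
    (h.integrable_negMulLog_jointDensity ht) fun z => ?_
  -- Where the density is positive, the initial constant bounds it from above, hence minus its
  -- logarithm from below. Since the total mass is 1, integration gives the initial entropy.
  obtain ⟨h0, h1⟩ := h.jointDensity_mem_Icc t z
  rcases h0.eq_or_lt with h0 | h0
  · simp [← h0]
  · have := mul_le_mul_of_nonneg_left (Real.log_le_log h0 h1) h0.le
    simp only [Real.negMulLog]
    linarith

variable {τ : ℝ} (hτ : 0 ≤ τ)
include hτ

/-- The entropy does not decrease when a coarse-grained density evolves and is coarse-grained
again. -/
lemma jointEntropy_le_coarseGrain_evolve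
    (hint : Integrable (fun z => Real.negMulLog (coarseGrain S.jointMeasure S.jointCell
      (evolveDensity U τ t (S.jointDensity U A k τ)) z)) S.jointMeasure) :
    S.jointEntropy U A k τ ≤ ∫ z, Real.negMulLog (coarseGrain S.jointMeasure S.jointCell
      (evolveDensity U τ t (S.jointDensity U A k τ)) z) ∂S.jointMeasure := by
  have hmp : MeasurePreserving (U t τ) S.jointMeasure S.jointMeasure :=
    h.evolution.measurePreserving h.regular ht hτ
  have hi := h.integrable_negMulLog_jointDensity hτ
  -- Evolution preserves volume and therefore the fine-grained entropy of the density it acts on;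
  -- only the subsequent averaging increases it.
  have he : S.jointEntropy U A k τ =
      ∫ z, Real.negMulLog (evolveDensity U τ t (S.jointDensity U A k τ) z) ∂S.jointMeasure := by
    have := integral_map (μ := S.jointMeasure) hmp.measurable.aemeasurable
      (f := fun z => Real.negMulLog (S.jointDensity U A k τ z))
      (by rw [hmp.map_eq]; exact hi.aestronglyMeasurable)
    rw [hmp.map_eq] at this
    exact this
  rw [he]
  exact integral_negMulLog_le_coarseGrain h.regular.measurableSet_jointCell h.jointCell_ne_top
    (fun z => (h.jointDensity_mem_Icc τ _).1)
    (hmp.integrable_comp_of_integrable (h.integrable_jointDensity hτ))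
    (hmp.integrable_comp_of_integrable hi) hint

lemma integrable_coarseGrain_evolve : Integrable (coarseGrain S.jointMeasure S.jointCell
      (evolveDensity U τ t (S.jointDensity U A k τ))) S.jointMeasure :=
  ((h.evolution.measurePreserving h.regular ht hτ).integrable_comp_of_integrable
    (h.integrable_jointDensity hτ)).coarseGrain h.regular.measurableSet_jointCell
      h.jointCell_ne_top

omit ht hτ in
-- Applied to the initial density, which coarse-graining leaves unchanged, the mixing identity says
-- that evolving and averaging the coarse-grained density at `τ` yields the one at `t + τ`. Neither
-- operation lowers the entropy.
lemma jointEntropy_mono_of_locallyMixing {τLM : ℝ} (hLM : 0 ≤ τLM)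
    (hmix : LocallyMixingBeyond S.jointMeasure S.jointCell U τLM) (ht : τLM ≤ t) (hτ : τLM ≤ τ) :
    S.jointEntropy U A k τ ≤ S.jointEntropy U A k (t + τ) := by
  have ht0 : 0 ≤ t := hLM.trans ht
  have hτ0 : 0 ≤ τ := hLM.trans hτ
  have hi := h.integrable_negMulLog_jointDensity (add_nonneg ht0 hτ0)
  have := hmix (S.initialDensity A k) h.integrable_initialDensity t τ ht hτ
  rw [h.coarseGrain_initialDensity] at this
  have heq : S.jointDensity U A k (t + τ) = coarseGrain S.jointMeasure S.jointCell
    (evolveDensity U τ (t + τ) (S.jointDensity U A k τ)) := this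
  have hE : S.jointEntropy U A k (t + τ) =
    ∫ z, Real.negMulLog (S.jointDensity U A k (t + τ) z) ∂S.jointMeasure := rfl
  rw [hE, heq]
  rw [heq] at hi
  exact h.jointEntropy_le_coarseGrain_evolve (add_nonneg ht0 hτ0) hτ0 hi

omit ht hτ in
/-- If the dynamics is locally mixing in the limit, the entropy of the whole eventually increases
up to an arbitrarily small error. -/
lemma exists_jointEntropy_le_add_of_locallyMixingInLimit
    (hmix : LocallyMixingInLimit S.jointMeasure S.jointCell U)
    (hfin : S.FiniteAccessibleVolume U A k) {e : ℝ} (he : 0 < e) :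
    ∃ τ₀, 0 ≤ τ₀ ∧ ∀ t τ, τ₀ ≤ t → τ₀ ≤ τ →
      S.jointEntropy U A k τ ≤ S.jointEntropy U A k (t + τ) + e := by
  obtain ⟨K, hK, hKfin, hvan⟩ := hfin
  set v := S.jointMeasure.real K
  have hv : 0 ≤ v := measureReal_nonneg
  -- The additive error of the modulus of continuity is integrated over `K` and thus costs at most
  -- e/2. The other half is left for `C` times the L¹ distance; adding 1 avoids division by zero in
  -- both places.
  set e₁ := e / (2 * (v + 1))
  have he₁ : 0 < e₁ := by positivity
  obtain ⟨C, hC, hφ⟩ := exists_abs_negMulLog_sub_le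
    (S.jointMeasure.real (S.cellSet A ×ˢ S.shellSet k))⁻¹ he₁
  have hlim := hmix (S.initialDensity A k) h.integrable_initialDensity
  rw [h.coarseGrain_initialDensity, Filter.prod_atTop_atTop_eq] at hlim
  have hpos : 0 < e / (2 * (C + 1)) := by positivity
  obtain ⟨⟨a, b⟩, hab⟩ := eventually_atTop.1 (hlim.eventually_lt_const hpos)
  refine ⟨max 0 (max a b), le_max_left _ _, fun t τ ht hτ => ?_⟩
  have ht0 : 0 ≤ t := (le_max_left _ _).trans ht
  have hτ0 : 0 ≤ τ := (le_max_left _ _).trans hτ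
  have htτ : 0 ≤ t + τ := add_nonneg ht0 hτ0
  have hI := hab (t, τ) (Prod.mk_le_mk.2
    ⟨((le_max_left a b).trans (le_max_right _ _)).trans ht,
      ((le_max_right a b).trans (le_max_right _ _)).trans hτ⟩)
  set ρ₁ := S.jointDensity U A k (t + τ)
  set ρ₂ := coarseGrain S.jointMeasure S.jointCell
    (evolveDensity U τ (t + τ) (S.jointDensity U A k τ))
  have hI' : ∫ z, |ρ₁ z - ρ₂ z| ∂S.jointMeasure < e / (2 * (C + 1)) := hI
  have hi₁ : Integrable ρ₁ S.jointMeasure := h.integrable_jointDensity htτ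
  have hi₂ : Integrable ρ₂ S.jointMeasure := h.integrable_coarseGrain_evolve htτ hτ0
  have hM : 0 ≤ (S.jointMeasure.real (S.cellSet A ×ˢ S.shellSet k))⁻¹ :=
    (inv_pos.2 h.initial_real_pos).le
  have hρ₁ := h.jointDensity_mem_Icc (t + τ)
  have hρ₂ : ∀ z, ρ₂ z ∈ Set.Icc 0 (S.jointMeasure.real (S.cellSet A ×ˢ S.shellSet k))⁻¹ :=
    coarseGrain_mem_Icc h.jointCell_ne_top hM fun z => h.jointDensity_mem_Icc τ _
  have hz₁ : ∀ z, z ∉ K → ρ₁ z = 0 := fun z hz => by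
    -- At intermediate time 0 the inner coarse-graining does nothing to the initial Boltzmann state,
    -- so the support condition covers the true coarse-grained density as well.
    have := hvan (t + τ) 0 htτ le_rfl z hz
    rw [h.density_zero, h.coarseGrain_initialDensity, add_zero] at this
    exact this
  have hz₂ : ∀ z, z ∉ K → ρ₂ z = 0 := fun z hz => hvan t τ ht0 hτ0 z hz
  have hiK : Integrable (K.indicator fun _ => e₁) S.jointMeasure :=
    (integrableOn_const hKfin.ne).integrable_indicator hK
  -- The entropy decomposition is not available for this density, which is re-coarse-grained at `τ`.
  -- Comparison with the value 0 bounds its entropy integrand by e₁ on `K` plus `C` times the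
  -- density.
  have hn₂ : Integrable (fun z => Real.negMulLog (ρ₂ z)) S.jointMeasure := by
    refine (hiK.add (hi₂.norm.const_mul C)).mono'
      (Real.continuous_negMulLog.comp_aestronglyMeasurable hi₂.aestronglyMeasurable)
      (Eventually.of_forall fun z => ?_)
    simp only [Pi.add_apply]
    by_cases hz : z ∈ K
    · have := hφ (ρ₂ z) (hρ₂ z) 0 ⟨le_rfl, hM⟩
      simpa [hz] using this
    · simp [hz, hz₂ z hz]
  have hn₁ : Integrable (fun z => Real.negMulLog (ρ₁ z)) S.jointMeasure :=
    h.integrable_negMulLog_jointDensity htτ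
  have hJ := h.jointEntropy_le_coarseGrain_evolve htτ hτ0 hn₂
  have hid : Integrable (fun z => C * |ρ₁ z - ρ₂ z|) S.jointMeasure :=
    ((hi₁.sub hi₂).abs).const_mul C
  have hdiff : ∫ z, Real.negMulLog (ρ₂ z) ∂S.jointMeasure -
      ∫ z, Real.negMulLog (ρ₁ z) ∂S.jointMeasure ≤
      ∫ z, (K.indicator (fun _ => e₁) z + C * |ρ₁ z - ρ₂ z|) ∂S.jointMeasure := by
    rw [← integral_sub hn₂ hn₁]
    refine integral_mono (hn₂.sub hn₁) (hiK.add hid) fun z => ?_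
    simp only
    by_cases hz : z ∈ K
    · have := (le_abs_self _).trans (hφ (ρ₂ z) (hρ₂ z) (ρ₁ z) (hρ₁ z))
      rw [abs_sub_comm (ρ₂ z)] at this
      simpa [hz] using this
    · simp [hz, hz₁ z hz, hz₂ z hz]
  rw [integral_add hiK hid, integral_indicator hK, setIntegral_const, integral_const_mul,
    smul_eq_mul] at hdiff
  have hA : v * e₁ ≤ e / 2 := by
    have : (v + 1) * e₁ = e / 2 := by simp only [e₁]; field_simp
    nlinarith
  have hB : C * ∫ z, |ρ₁ z - ρ₂ z| ∂S.jointMeasure ≤ e / 2 := by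
    have h1 := mul_le_mul_of_nonneg_left hI'.le hC
    have h2 : (C + 1) * (e / (2 * (C + 1))) = e / 2 := by field_simp
    nlinarith
  have hS : S.jointEntropy U A k (t + τ) = ∫ z, Real.negMulLog (ρ₁ z) ∂S.jointMeasure := rfl
  rw [hS]
  linarith

end ThermalRun

end DrivenSystemWithBath

/-! ### The principle of maximal work -/

theorem theorem4 {n m : ℕ} {ι : Type*} [Countable ι] (S : DrivenSystemWithBath n m ι)
    (hS : S.Regular)
    (U : ℝ → ℝ → PhaseSpace n × PhaseSpace m → PhaseSpace n × PhaseSpace m)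
    (hU : S.IsEvolution U)
    (T ε δ : ℝ) (hT : 0 < T) (η : ℝ → ℝ≥0)
    (A : ι) (k : ℤ) (hk : (S.shellSet k).Nonempty)
    (hbath : S.Thermostated U T ε δ η A k)
    (hfin : S.FiniteAverages U A k) :
    (∀ t, 0 ≤ t →
      S.freeEnergyChange U T A k t ≤
        S.averageWork U A k t + (2 * ε + 2 * δ + S.width + T * η t)) ∧
    (∀ τLM, 0 ≤ τLM → LocallyMixingBeyond S.jointMeasure S.jointCell U τLM →
      ∀ t τ, τLM ≤ t → τLM ≤ τ →
        S.excessWork U T A k τ ≤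
          S.excessWork U T A k (t + τ) + (2 * ε + 2 * δ + S.width + T * η (t + τ))) ∧
    (LocallyMixingInLimit S.jointMeasure S.jointCell U → S.FiniteAccessibleVolume U A k →
      ∀ ε' : ℝ, 0 < ε' → ∃ τ₀, 0 ≤ τ₀ ∧ ∀ t τ, τ₀ ≤ t → τ₀ ≤ τ →
        S.excessWork U T A k τ ≤
          S.excessWork U T A k (t + τ) +
            (2 * ε + 2 * δ + S.width + T * η (t + τ)) + ε') := by
  have h : S.ThermalRun U T ε δ η A k := ⟨hS, hU, hT, hk, hbath, hfin⟩
  refine ⟨fun t ht => ?_, fun τLM hLM hmix t τ ht hτ => ?_, fun hmix hvol ε' hε' => ?_⟩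
  -- Comparison with time 0, where the excess work is zero.
  · have h1 := h.excessWork_le ht le_rfl
    have h2 := mul_nonneg hT.le (sub_nonneg.2 (h.jointEntropy_zero_le ht))
    have h3 : S.excessWork U T A k 0 = 0 := by
      rw [DrivenSystemWithBath.excessWork, h.averageWork_eq le_rfl,
        DrivenSystemWithBath.freeEnergyChange]
      ring
    rw [h3] at h1
    simp only [DrivenSystemWithBath.excessWork] at h1
    linarith
  · have hτ0 := hLM.trans hτ
    have h1 := h.excessWork_le (add_nonneg (hLM.trans ht) hτ0) hτ0
    have h2 := mul_nonneg hT.le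
      (sub_nonneg.2 (h.jointEntropy_mono_of_locallyMixing hLM hmix ht hτ))
    linarith
  · obtain ⟨τ₀, hτ₀, hS'⟩ :=
      -- The entropy enters the balance multiplied by `T`, hence the tolerance ε'/T.
      h.exists_jointEntropy_le_add_of_locallyMixingInLimit hmix hvol (div_pos hε' hT)
    refine ⟨τ₀, hτ₀, fun t τ ht hτ => ?_⟩
    have hτ0 := hτ₀.trans hτ
    have h1 := h.excessWork_le (add_nonneg (hτ₀.trans ht) hτ0) hτ0
    have h2 := mul_le_mul_of_nonneg_left (sub_le_iff_le_add'.2 (hS' t τ ht hτ)) hT.le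
    rw [mul_div_cancel₀ _ hT.ne'] at h2
    simp only [mul_sub] at h1 h2
    linarith
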